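/- **Setting.** A two-player zero-sum Markov game has $H$ steps, a measurable state space $\mathcal S$, finite nonempty action sets $\mathcal A_1,\mathcal A_2$, deterministic rewards $r_h(s,a,b)\in[0,1]$ and transition kernels $\mathbb P_h(\cdot\mid s,a,b)$. For Markov policies $\pi,\nu$ of the maximizing and the minimizing player let $V_h^{\pi,\nu}(s)=\mathbb E_{\pi,\nu}\big[\sum_{h'=h}^H r_{h'}(s_{h'},a_{h'},b_{h'})\mid s_h=s\big]$. A Nash equilibrium is a pair $(\pi^*,\nu^*)$ with $V_h^{\pi,\nu^*}(s)\le V_h^{\pi^*,\nu^*}(s)\le V_h^{\pi^*,\nu}(s)$ for all $\pi,\nu,h,s$. The duality gap of $(\pi,\nu)$ at the initial state $x$ is $\mathrm{SubOpt}((\pi,\nu),x)=\sup_{\pi'}V_1^{\pi',\nu}(x)-\inf_{\nu'}V_1^{\pi,\nu'}(x)$. The game is *linear* of dimension $d$: there are a known measurable feature map $\phi:\mathcal S\times\mathcal A_1\times\mathcal A_2\to\mathbb R^d$, vectors $\theta_h\in\mathbb R^d$ and $d$-vectors $\mu_h$ of finite signed measures on $\mathcal S$ with $r_h=\phi^\top\theta_h$,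 $\mathbb P_h(\cdot\mid s,a,b)=\phi(s,a,b)^\top\mu_h(\cdot)$, $\|\phi\|\le1$, $\|\theta_h\|\le\sqrt d$ and $\|\mu_h(\mathcal S)\|\le\sqrt d$ (Euclidean norms). A random dataset of states, actions and rewards $(s_h^\tau,a_h^\tau,b_h^\tau,r_h^\tau)$, $\tau\le K$, $h\le H$, is *compliant* with the game if, for all $h$ and $\tau$, the conditional law of $(r_h^\tau,s_{h+1}^\tau)$ given $\{(s_h^i,a_h^i,b_h^i)\}_{i\le\tau}$ and $\{(r_h^i,s_{h+1}^i)\}_{i<\tau}$ is the one prescribed by $r_h$ and $\mathbb P_h$ at $(s_h^\tau,a_h^\tau,b_h^\tau)$. Put $\phi_h=\phi(s_h,a_h,b_h)$, $\phi_h^\tau=\phi(s_h^\tau,a_h^\tau,b_h^\tau)$, $\Lambda_h=I+\sum_{\tau=1}^K\phi_h^\tau(\phi_h^\tau)^\top$. *Pessimistic minimax value iteration* (PMVI) with parameter $\beta$ starts from $\underline V_{H+1}=\overline V_{H+1}=0$ and computes for $h=H,\dots,1$: $\underline w_h=\Lambda_h^{-1}\sum_\tau\phi_h^\tau\big(r_h^\tau+\underline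 V_{h+1}(s_{h+1}^\tau)\big)$, and $\overline w_h$ likewise from $\overline V_{h+1}$; $\Gamma_h=\beta\sqrt{\phi^\top\Lambda_h^{-1}\phi}$; $\underline Q_h=\Pi_{H-h+1}(\phi^\top\underline w_h-\Gamma_h)$ and $\overline Q_h=\Pi_{H-h+1}(\phi^\top\overline w_h+\Gamma_h)$, where $\Pi_m(y)=\min\{m,\max\{y,0\}\}$; Nash equilibria $(\hat\pi_h,\nu_h')$ and $(\pi_h',\hat\nu_h)$, in every state, of the matrix games with payoffs $\underline Q_h$ and $\overline Q_h$; and the values $\underline V_h,\overline V_h$ of these equilibria. Its output is $(\hat\pi,\hat\nu)$. **Claim.** There is an absolute constant $c_0>0$ such that for all $c\ge c_0$ and $c_1>0$ there is a constant $c'>0$, depending only on $c$ and $c_1$, with the following property. Let $p\in(0,1)$, and let $K$ be sufficiently large, namely $K\ge K_0$ with $K_0$ depending only on $c,c_1,d,H,p$ and on a bound for the total variations of the signed measures $\mu_h^{(i)}$. Consider a linear Markov game, a Nash equilibrium $(\pi^*,\nu^*)$ of it, an initial state $x$, and a compliant dataset of $K$ trajectories such that with probability at least $1-p/2$, for all $h\in[H]$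 (in the Loewner order) $$\Lambda_h\succeq I+c_1K\,\mathbb E_{\pi^*,\nu}[\phi_h\phi_h^\top\mid s_1=x]\ \text{ for all }\nu\quad\text{and}\quad\Lambda_h\succeq I+c_1K\,\mathbb E_{\pi,\nu^*}[\phi_h\phi_h^\top\mid s_1=x]\ \text{ for all }\pi .$$ Let $\zeta=\log(4dHK/p)$ and $\beta=c\,d\,H\sqrt\zeta$. Then, with probability at least $1-p$, every output $(\hat\pi,\hat\nu)$ of PMVI with parameter $\beta$ satisfies $$\mathrm{SubOpt}\big((\hat\pi,\hat\nu),x\big)\le c'\,d^{3/2}H^2K^{-1/2}\sqrt\zeta .$$ -/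

import Mathlib

open MeasureTheory ProbabilityTheory
open scoped Matrix

noncomputable section

/-- A two-player zero-sum Markov game with `H` steps, state space `S` and action spaces `A`
(max-player) and `B` (min-player). Steps are indexed by `Fin H`, so `h : Fin H` is the
`(h + 1)`-st step; the states carry the indices `Fin (H + 1)`, and step `h` leads from the state
with index `h.castSucc` to the one with index `h.succ`. -/
structure MarkovGame (S A B : Type*) [MeasurableSpace S] [MeasurableSpace A] [MeasurableSpace B]
    (H : ℕ) where
  reward : Fin H → S × A × B → ℝ
  measurable_reward : ∀ h, Measurable (reward h)
  reward_mem : ∀ h z, reward h z ∈ Set.Icc (0 : ℝ) 1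
  trans : Fin H → Kernel (S × A × B) S
  markov_trans : ∀ h, IsMarkovKernel (trans h)

/-- A Markov policy: at each step a (measurable) map from states to distributions over actions. -/
structure Policy (S A : Type*) [MeasurableSpace S] [MeasurableSpace A] (H : ℕ) where
  act : Fin H → Kernel S A
  markov_act : ∀ h, IsMarkovKernel (act h)

namespace MarkovGame

variable {S A B : Type*} [MeasurableSpace S] [MeasurableSpace A] [MeasurableSpace B] {H : ℕ}

/-- The law of `(s_k, a_k, b_k)` given `s_k`, when the two players draw their actions
independently from `π` and `ν`. -/
def playKernel (π : Policy S A H) (ν : Policy S B H) (k : Fin H) : Kernel S (S × A × B) :=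
  Kernel.id ×ₖ (π.act k ×ₖ ν.act k)

/-- The law of the state `s_k` given `s_h`, for `h ≤ k`, under `(π, ν)`: started at index `h`, the
state moves at each step `j ≥ h` according to the policies and the transition kernel. -/
def stateLaw (M : MarkovGame S A B H) (π : Policy S A H) (ν : Policy S B H) (h k : Fin (H + 1)) :
    Kernel S S :=
  Fin.induction (motive := fun _ => Kernel S S) Kernel.id
    (fun j κ => if h ≤ j.castSucc then M.trans j ∘ₖ (playKernel π ν j ∘ₖ κ) else Kernel.id) k

/-- `E_{π,ν}[f(s_k, a_k, b_k) | s_h = s]`, for `h ≤ k`. -/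
def expect (M : MarkovGame S A B H) (π : Policy S A H) (ν : Policy S B H) (h : Fin (H + 1)) (s : S)
    (k : Fin H) (f : S × A × B → ℝ) : ℝ :=
  ∫ z, f z ∂((playKernel π ν k ∘ₖ M.stateLaw π ν h k.castSucc) s)

/-- The value function `V_h^{π,ν}(s)`: the expected total reward of the steps from `h` on
(zero for the last index, after all the steps). -/
def value (M : MarkovGame S A B H) (π : Policy S A H) (ν : Policy S B H) (h : Fin (H + 1)) (s : S) :
    ℝ :=
  ∑ k : Fin H with h ≤ k.castSucc, M.expect π ν h s k (M.reward k)

/-- `(π, ν)` is a Nash equilibrium: each policy is a best response to the other one, at every step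
and in every state. -/
def IsNash (M : MarkovGame S A B H) (π : Policy S A H) (ν : Policy S B H) : Prop :=
  ∀ (h : Fin (H + 1)) (s : S),
    (∀ π' : Policy S A H, M.value π' ν h s ≤ M.value π ν h s) ∧
    (∀ ν' : Policy S B H, M.value π ν h s ≤ M.value π ν' h s)

/-- The duality gap `V_1^{*,ν}(x) - V_1^{π,*}(x)`. -/
def dualityGap (M : MarkovGame S A B H) (π : Policy S A H) (ν : Policy S B H) (x : S) : ℝ :=
  (⨆ π' : Policy S A H, M.value π' ν 0 x) - ⨅ ν' : Policy S B H, M.value π ν' 0 x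

/-- The matrix `E_{π,ν}[φ_k φ_kᵀ | s_1 = x]`. -/
def featureMoment {d : ℕ} (M : MarkovGame S A B H) (φ : S × A × B → EuclideanSpace ℝ (Fin d))
    (π : Policy S A H) (ν : Policy S B H) (x : S) (k : Fin H) : Matrix (Fin d) (Fin d) ℝ :=
  Matrix.of fun i j => M.expect π ν 0 x k fun z => φ z i * φ z j

/-- `M` is a linear Markov game with feature map `φ`, reward parameters `θ` and vectors of signed
measures `μ`. -/
structure IsLinear {d : ℕ} (M : MarkovGame S A B H) (φ : S × A × B → EuclideanSpace ℝ (Fin d))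
    (θ : Fin H → EuclideanSpace ℝ (Fin d)) (μ : Fin H → Fin d → SignedMeasure S) : Prop where
  measurable_feature : Measurable φ
  reward_eq : ∀ h z, M.reward h z = ∑ i, φ z i * θ h i
  trans_eq : ∀ h z (E : Set S), MeasurableSet E → (M.trans h z).real E = ∑ i, φ z i * μ h i E
  norm_feature_le : ∀ z, ‖φ z‖ ≤ 1
  norm_theta_le : ∀ h, ‖θ h‖ ≤ √(d : ℝ)
  norm_mu_le : ∀ h,
    ‖(WithLp.toLp 2 fun i => μ h i Set.univ : EuclideanSpace ℝ (Fin d))‖ ≤ √(d : ℝ)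

end MarkovGame

/-- A dataset of `K` trajectories. The state after the last step, of index `Fin.last H`, is only a
bookkeeping device: the algorithm evaluates the zero function at it. -/
structure Dataset (S A B : Type*) (H K : ℕ) where
  state : Fin (H + 1) → Fin K → S
  act₁ : Fin H → Fin K → A
  act₂ : Fin H → Fin K → B
  rew : Fin H → Fin K → ℝ

namespace Dataset

variable {S A B : Type*} {H K d : ℕ}

/-- The triple `(s_h^τ, a_h^τ, b_h^τ)`. -/
def triple (D : Dataset S A B H K) (h : Fin H) (τ : Fin K) : S × A × B :=
  (D.state h.castSucc τ, D.act₁ h τ, D.act₂ h τ)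

/-- The pair `(r_h^τ, s_{h+1}^τ)`. -/
def outcome (D : Dataset S A B H K) (h : Fin H) (τ : Fin K) : ℝ × S :=
  (D.rew h τ, D.state h.succ τ)

/-- The sigma-algebra generated by `(s_h^i, a_h^i, b_h^i)`, `i ≤ τ`, and
`(r_h^i, s_{h+1}^i)`, `i < τ`. -/
abbrev history {Ω : Type*} [MeasurableSpace S] [MeasurableSpace A] [MeasurableSpace B]
    (D : Ω → Dataset S A B H K) (h : Fin H) (τ : Fin K) : MeasurableSpace Ω :=
  (⨆ i ∈ Set.Iic τ, MeasurableSpace.comap (fun ω => (D ω).triple h i) inferInstance) ⊔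
    (⨆ i ∈ Set.Iio τ, MeasurableSpace.comap (fun ω => (D ω).outcome h i) inferInstance)

/-- The random dataset `D` is compliant with the game `M`: conditionally on its history, the pair
`(r_h^τ, s_{h+1}^τ)` is drawn from the (deterministic) reward function and the transition kernel
of `M` at `(s_h^τ, a_h^τ, b_h^τ)`. -/
structure IsCompliant {Ω : Type*} [MeasurableSpace Ω] [MeasurableSpace S] [MeasurableSpace A]
    [MeasurableSpace B] (P : Measure Ω) (M : MarkovGame S A B H) (D : Ω → Dataset S A B H K) :
    Prop where
  measurable_state : ∀ h τ, Measurable fun ω => (D ω).state h τ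
  measurable_act₁ : ∀ h τ, Measurable fun ω => (D ω).act₁ h τ
  measurable_act₂ : ∀ h τ, Measurable fun ω => (D ω).act₂ h τ
  measurable_rew : ∀ h τ, Measurable fun ω => (D ω).rew h τ
  condLaw : ∀ (h : Fin H) (τ : Fin K) (E : Set (ℝ × S)), MeasurableSet E →
    P⟦(fun ω => (D ω).outcome h τ) ⁻¹' E | history D h τ⟧ =ᵐ[P] fun ω =>
      ((Measure.dirac (M.reward h ((D ω).triple h τ))).prod
        (M.trans h ((D ω).triple h τ))).real E

/-- `Λ_h = ∑_τ φ_h^τ (φ_h^τ)ᵀ + I`. -/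
def gram (φ : S × A × B → EuclideanSpace ℝ (Fin d)) (D : Dataset S A B H K) (h : Fin H) :
    Matrix (Fin d) (Fin d) ℝ :=
  (∑ τ, Matrix.of fun i j => φ (D.triple h τ) i * φ (D.triple h τ) j) + 1

/-- The ridge regression weights `Λ_h⁻¹ ∑_τ φ_h^τ (r_h^τ + V(s_{h+1}^τ))`. -/
def ridge (φ : S × A × B → EuclideanSpace ℝ (Fin d)) (D : Dataset S A B H K) (h : Fin H)
    (V : S → ℝ) : Fin d → ℝ :=
  (D.gram φ h)⁻¹ *ᵥ fun i => ∑ τ, φ (D.triple h τ) i * (D.rew h τ + V (D.state h.succ τ))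

/-- The bonus `Γ_h = β √(φᵀ Λ_h⁻¹ φ)`. -/
def bonus (φ : S × A × B → EuclideanSpace ℝ (Fin d)) (β : ℝ) (D : Dataset S A B H K) (h : Fin H)
    (z : S × A × B) : ℝ :=
  β * √((φ z).ofLp ⬝ᵥ (D.gram φ h)⁻¹ *ᵥ (φ z).ofLp)

/-- The sufficient coverage event: for every step `h`,
`Λ_h ⪰ I + c₁ K E_{π*,ν}[φ_h φ_hᵀ | s_1 = x]` for all `ν` and
`Λ_h ⪰ I + c₁ K E_{π,ν*}[φ_h φ_hᵀ | s_1 = x]` for all `π`. -/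
def Covers [MeasurableSpace S] [MeasurableSpace A] [MeasurableSpace B] (D : Dataset S A B H K)
    (M : MarkovGame S A B H) (φ : S × A × B → EuclideanSpace ℝ (Fin d)) (c₁ : ℝ)
    (πs : Policy S A H) (νs : Policy S B H) (x : S) : Prop :=
  ∀ h : Fin H,
    (∀ ν : Policy S B H,
      (D.gram φ h - (1 + (c₁ * K) • M.featureMoment φ πs ν x h)).PosSemidef) ∧
    (∀ π : Policy S A H,
      (D.gram φ h - (1 + (c₁ * K) • M.featureMoment φ π νs x h)).PosSemidef)

end Dataset

/-- `Π_h(x) = min {h, max {x, 0}}`. -/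
def regulate (h : ℕ) (x : ℝ) : ℝ := min (h : ℝ) (max x 0)

/-- The payoff `E_{a ∼ p, b ∼ q} Q(a, b)` of the mixed strategies `p`, `q`. -/
def matrixPayoff {A B : Type*} [MeasurableSpace A] [MeasurableSpace B] (Q : A → B → ℝ)
    (p : Measure A) (q : Measure B) : ℝ :=
  ∫ a, ∫ b, Q a b ∂q ∂p

/-- `(p, q)` is a Nash equilibrium of the zero-sum matrix game with payoff matrix `Q`. -/
def IsMatrixNash {A B : Type*} [MeasurableSpace A] [MeasurableSpace B] (Q : A → B → ℝ)
    (p : Measure A) (q : Measure B) : Prop :=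
  (∀ p' : Measure A, IsProbabilityMeasure p' → matrixPayoff Q p' q ≤ matrixPayoff Q p q) ∧
  (∀ q' : Measure B, IsProbabilityMeasure q' → matrixPayoff Q p q ≤ matrixPayoff Q p q')

/-- One half of pessimistic minimax value iteration: backward value iteration on the dataset `D`
with the signed bonus `ε Γ_h` (`ε = -1` for the lower and `ε = 1` for the upper estimates), where
`(p_h, q_h)` is a Nash equilibrium of the matrix game with payoff `Q_h` in every state.
With the steps counted from zero, step `h` has `H - h` steps to go, the truncation level. -/
structure IsValueIteration {S A B : Type*} [MeasurableSpace S] [MeasurableSpace A]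
    [MeasurableSpace B] {H K d : ℕ} (φ : S × A × B → EuclideanSpace ℝ (Fin d)) (β ε : ℝ)
    (D : Dataset S A B H K) (V : Fin (H + 1) → S → ℝ) (Q : Fin H → S → A → B → ℝ)
    (p : Policy S A H) (q : Policy S B H) : Prop where
  terminal : ∀ s, V (Fin.last H) s = 0
  estimate : ∀ h s a b, Q h s a b =
    regulate (H - h) ((φ (s, a, b)).ofLp ⬝ᵥ D.ridge φ h (V h.succ) + ε * D.bonus φ β h (s, a, b))
  nash : ∀ h s, IsMatrixNash (Q h s) (p.act h s) (q.act h s)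
  value : ∀ h s, V h.castSucc s = matrixPayoff (Q h s) (p.act h s) (q.act h s)

/-- `(π̂, ν̂)` is an output of pessimistic minimax value iteration with parameter `β` on the
dataset `D`, for some choice of the Nash equilibria of the matrix games. -/
def IsPMVIOutput {S A B : Type*} [MeasurableSpace S] [MeasurableSpace A] [MeasurableSpace B]
    {H K d : ℕ} (φ : S × A × B → EuclideanSpace ℝ (Fin d)) (β : ℝ) (D : Dataset S A B H K)
    (πhat : Policy S A H) (νhat : Policy S B H) : Prop :=
  (∃ V Q, ∃ ν' : Policy S B H, IsValueIteration φ β (-1) D V Q πhat ν') ∧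
  (∃ V Q, ∃ π' : Policy S A H, IsValueIteration φ β 1 D V Q π' νhat)

end

/-! The proof separates a deterministic comparison from a concentration argument.

Deterministic part. Suppose that, at every step and every triple, the regression prediction differs
from the true Bellman backup of the computed value function by at most the bonus. Truncation is
harmless because the backup already lies in the truncation range, so subtracting the bonus
underestimates the backup by at most two bonuses, and adding it overestimates by at most two.
Telescoping along trajectories (`MarkovGame.le_sum_expect`) gives `IsValueIteration.le_value` and
`IsValueIteration.value_le`: the gap is at most the upper minus the lower value at `x`. The same
telescoping, now against `νs` and `πs`, bounds each of these values by the Nash value up to twice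
the expected bonuses along `(π', νs)` or `(πs, ν')`. The opponents `π'`, `ν'` are data-dependent,
which is why coverage is required against all policies. Coverage and a trace inequality bound each
expected bonus by `β √(d / (c₁ K))` (`Dataset.expect_bonus_le`), hence the gap by `4 H` times that
(`MarkovGame.dualityGap_le`).

Concentration part. Linearity writes the backup as `φᵀw`. The ridge error then splits into a
regularization term, governed by the Euclidean norm of `w`, and a noise term, governed by the
`Λ⁻¹`-norm of the feature-weighted noise. The norm of `w` involves the total variations of the
signed measures, absorbed by `√ζ` once `K` is large. The regressed value function depends on the
same data, so the noise bound must be uniform over a class containing it: values of matrix games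
indexed by a weight vector and a matrix. For a fixed function and a fixed direction `v`, Hoeffding's
lemma gives an exponential supermartingale. A finite net handles the functions and the directions
simultaneously, and the direction `H⁻² Λ⁻¹ s` converts the linear bound into a bound on `sᵀ Λ⁻¹ s`.
-/

open scoped ENNReal

/-! ### Positive definite matrices and entrywise bounds. -/

namespace Matrix

variable {n : Type*} [Fintype n]

lemma PosSemidef.dotProduct_mulVec_sq_le {A : Matrix n n ℝ} (hA : A.PosSemidef) (u v : n → ℝ) :
    (u ⬝ᵥ A *ᵥ v) ^ 2 ≤ (u ⬝ᵥ A *ᵥ u) * (v ⬝ᵥ A *ᵥ v) := by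
  classical
  have h := LinearMap.BilinForm.apply_sq_le_of_symm (Matrix.toBilin' A)
    (fun x => by simpa [Matrix.toBilin'_apply'] using hA.dotProduct_mulVec_nonneg x)
    ⟨fun x y => by
      have hs : Aᵀ = A := by simpa using hA.1.eq
      simp only [Matrix.toBilin'_apply', RingHom.id_apply]
      rw [Matrix.dotProduct_mulVec, ← Matrix.mulVec_transpose, hs, dotProduct_comm]⟩ u v
  simpa [Matrix.toBilin'_apply'] using h

open scoped MatrixOrder in
-- Factoring `A = Cᴴ C` and cycling the trace turns the product into the semidefinite matrix `C B
-- Cᴴ`.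
lemma PosSemidef.trace_mul_nonneg {A B : Matrix n n ℝ} (hA : A.PosSemidef)
    (hB : B.PosSemidef) : 0 ≤ (A * B).trace := by
  classical
  obtain ⟨C, rfl⟩ : ∃ C : Matrix n n ℝ, A = Cᴴ * C := by
    exact CStarAlgebra.nonneg_iff_eq_star_mul_self.mp hA.nonneg
  rw [Matrix.mul_assoc, Matrix.trace_mul_comm]
  exact (hB.mul_mul_conjTranspose_same C).trace_nonneg

variable [DecidableEq n]

/-- With `v = G⁻¹ u`, the hypothesis at `v` reads `v·v ≤ u·v`; inserting this into `0 ≤ (u - v)·(u -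
v)` gives `u·v ≤ u·u`. -/
lemma PosDef.dotProduct_inv_mulVec_bounds {G : Matrix n n ℝ} (hG : G.PosDef)
    (h1 : ∀ v : n → ℝ, v ⬝ᵥ v ≤ v ⬝ᵥ G *ᵥ v) (u : n → ℝ) :
    (G⁻¹ *ᵥ u) ⬝ᵥ (G⁻¹ *ᵥ u) ≤ u ⬝ᵥ G⁻¹ *ᵥ u ∧ u ⬝ᵥ G⁻¹ *ᵥ u ≤ u ⬝ᵥ u := by
  set v := G⁻¹ *ᵥ u with hv
  have hGv : G *ᵥ v = u := by
    rw [hv, mulVec_mulVec, mul_nonsing_inv _ ((isUnit_iff_isUnit_det _).mp hG.isUnit),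
      one_mulVec]
  have h2 := h1 v
  rw [hGv, dotProduct_comm v u] at h2
  refine ⟨h2, ?_⟩
  have h3 : 0 ≤ (u - v) ⬝ᵥ (u - v) := by simpa using dotProduct_star_self_nonneg (u - v)
  rw [sub_dotProduct, dotProduct_sub, dotProduct_sub, dotProduct_comm v u] at h3
  linarith

/-- Column `j` of `G⁻¹` is the image of a unit vector and so has norm at most one. This places the
inverse Gram matrix in a fixed box that a finite net can cover. -/
lemma PosDef.abs_inv_apply_le {G : Matrix n n ℝ} (hG : G.PosDef)
    (h1 : ∀ v : n → ℝ, v ⬝ᵥ v ≤ v ⬝ᵥ G *ᵥ v) (i j : n) : |G⁻¹ i j| ≤ 1 := by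
  have h := hG.dotProduct_inv_mulVec_bounds h1 (Pi.single j 1)
  have h2 := h.1.trans h.2
  simp only [mulVec_single_one, single_dotProduct, Pi.single_eq_same, mul_one] at h2
  have h3 : G⁻¹ i j * G⁻¹ i j ≤ G⁻¹.col j ⬝ᵥ G⁻¹.col j :=
    Finset.single_le_sum (f := fun i => G⁻¹ i j * G⁻¹ i j)
      (fun i _ => mul_self_nonneg _) (Finset.mem_univ i)
  rw [abs_le_one_iff_mul_self_le_one]
  linarith

lemma abs_dotProduct_le_sum {d : ℕ} (u v : Fin d → ℝ) {a b : ℝ} (ha : 0 ≤ a)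
    (hu : ∀ i, |u i| ≤ a) (hv : ∀ i, |v i| ≤ b) : |u ⬝ᵥ v| ≤ d * (a * b) := by
  refine (Finset.abs_sum_le_sum_abs _ _).trans ?_
  refine (Finset.sum_le_sum (g := fun _ => a * b) fun i _ => ?_).trans (by simp)
  rw [abs_mul]
  exact mul_le_mul (hu i) (hv i) (abs_nonneg _) ha

end Matrix

/-- Rounding every coordinate down to the grid of mesh `η` leaves `2N + 1` values per coordinate.
One representative is chosen in each nonempty cell, so the net lies in `X` itself and its points
inherit the properties that define `X`. -/
lemma exists_finset_cover {X ι : Type*} [Fintype ι] (f : X → ι → ℝ) (N : ℕ) {η : ℝ} (hη : 0 < η)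
    (hf : ∀ x i, |f x i| ≤ N * η) :
    ∃ T : Finset X, T.card ≤ (2 * N + 1) ^ Fintype.card ι ∧
      ∀ x, ∃ y ∈ T, ∀ i, |f x i - f y i| ≤ η := by
  classical
  have hmem : ∀ x i, ⌊f x i / η⌋ ∈ Finset.Icc (-(N : ℤ)) N := by
    intro x i
    have h := abs_le.mp (hf x i)
    rw [Finset.mem_Icc]
    constructor
    · rw [Int.le_floor]
      push_cast
      rw [le_div_iff₀ hη]
      linarith
    · have h2 : f x i / η ≤ N := by rw [div_le_iff₀ hη]; exact h.2
      exact_mod_cast (Int.floor_le _).trans h2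
  let g : X → ι → Finset.Icc (-(N : ℤ)) N := fun x i => ⟨_, hmem x i⟩
  refine ⟨(Finset.univ : Finset (Set.range g)).image fun c => c.2.choose, ?_, fun x => ?_⟩
  · refine Finset.card_image_le.trans ?_
    rw [Finset.card_univ]
    refine (Fintype.card_subtype_le _).trans ?_
    rw [Fintype.card_fun, Fintype.card_coe, Int.card_Icc]
    apply le_of_eq
    congr 1
    omega
  · have hx : g x ∈ Set.range g := ⟨x, rfl⟩
    refine ⟨hx.choose, Finset.mem_image.mpr ⟨⟨g x, hx⟩, Finset.mem_univ _, rfl⟩, fun i => ?_⟩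
    have h := congrArg (fun c => ((c i : Finset.Icc (-(N : ℤ)) N) : ℤ)) hx.choose_spec
    have h2 : |f hx.choose i / η - f x i / η| < 1 := Int.abs_sub_lt_one_of_floor_eq_floor h
    rw [← sub_div, abs_div, abs_of_pos hη, div_lt_one hη, abs_sub_comm] at h2
    exact h2.le

lemma EuclideanSpace.dotProduct_self_eq {d : ℕ} (u : EuclideanSpace ℝ (Fin d)) :
    u.ofLp ⬝ᵥ u.ofLp = ‖u‖ ^ 2 := by
  rw [EuclideanSpace.real_norm_sq_eq]
  simp [dotProduct, sq]

lemma EuclideanSpace.abs_apply_le_norm {d : ℕ} (u : EuclideanSpace ℝ (Fin d)) (i : Fin d) :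
    |u i| ≤ ‖u‖ := PiLp.norm_apply_le u i

/-! ### The regularized Gram matrix. -/

namespace Dataset

variable {S A B : Type*} {H K d : ℕ}

lemma dotProduct_gram (φ : S × A × B → EuclideanSpace ℝ (Fin d)) (D : Dataset S A B H K)
    (h : Fin H) (u v : Fin d → ℝ) :
    u ⬝ᵥ D.gram φ h *ᵥ v =
      ∑ τ, (u ⬝ᵥ (φ (D.triple h τ)).ofLp) * ((φ (D.triple h τ)).ofLp ⬝ᵥ v) + u ⬝ᵥ v := by
  rw [gram, Matrix.add_mulVec, Matrix.one_mulVec, dotProduct_add, Matrix.sum_mulVec,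
    dotProduct_sum]
  congr 1
  refine Finset.sum_congr rfl fun τ _ => ?_
  simp only [dotProduct, Matrix.mulVec, Matrix.of_apply, Finset.sum_mul, Finset.mul_sum]
  rw [Finset.sum_comm]
  refine Finset.sum_congr rfl fun i _ => Finset.sum_congr rfl fun j _ => ?_
  ring

lemma gram_isHermitian (φ : S × A × B → EuclideanSpace ℝ (Fin d)) (D : Dataset S A B H K)
    (h : Fin H) : (D.gram φ h).IsHermitian := by
  ext i j
  simp only [gram, Matrix.conjTranspose_apply, Matrix.add_apply, Matrix.sum_apply,
    Matrix.of_apply, star_trivial, Matrix.one_apply, mul_comm, eq_comm]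

lemma dotProduct_self_le_gram (φ : S × A × B → EuclideanSpace ℝ (Fin d)) (D : Dataset S A B H K)
    (h : Fin H) (v : Fin d → ℝ) : v ⬝ᵥ v ≤ v ⬝ᵥ D.gram φ h *ᵥ v := by
  rw [dotProduct_gram]
  refine le_add_of_nonneg_left (Finset.sum_nonneg fun τ _ => ?_)
  rw [dotProduct_comm]
  exact mul_self_nonneg _

lemma gram_posDef (φ : S × A × B → EuclideanSpace ℝ (Fin d)) (D : Dataset S A B H K)
    (h : Fin H) : (D.gram φ h).PosDef := by
  refine .of_dotProduct_mulVec_pos (gram_isHermitian φ D h) fun v hv => ?_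
  have h1 : 0 < v ⬝ᵥ v := by simpa using Matrix.dotProduct_star_self_pos_iff.mpr hv
  simpa using h1.trans_le (dotProduct_self_le_gram φ D h v)

/-- A lower bound for the Gram matrix bounds the trace of its inverse against the moment matrix. -/
lemma trace_inv_gram_mul_le (φ : S × A × B → EuclideanSpace ℝ (Fin d)) (D : Dataset S A B H K)
    (h : Fin H) {a : ℝ} {Φ : Matrix (Fin d) (Fin d) ℝ}
    (hc : (D.gram φ h - (1 + a • Φ)).PosSemidef) :
    a * ((D.gram φ h)⁻¹ * Φ).trace ≤ d := by
  have hG := gram_posDef φ D h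
  -- The trace of `Λ⁻¹ (Λ - 1 - aΦ)` is nonnegative and equals `d - tr Λ⁻¹ - a tr (Λ⁻¹ Φ)`.
  have h1 := hG.inv.posSemidef.trace_mul_nonneg hc
  have h2 := hG.inv.posSemidef.trace_nonneg
  rw [Matrix.mul_sub, Matrix.mul_add, Matrix.nonsing_inv_mul _
    ((Matrix.isUnit_iff_isUnit_det _).mp hG.isUnit), Matrix.trace_sub, Matrix.trace_add,
    Matrix.trace_one, Matrix.mul_one, Matrix.mul_smul, Matrix.trace_smul, Fintype.card_fin,
    smul_eq_mul] at h1
  linarith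

lemma abs_inv_gram_mulVec_le (φ : S × A × B → EuclideanSpace ℝ (Fin d)) (D : Dataset S A B H K)
    (h : Fin H) {y : Fin d → ℝ} {R : ℝ}
    (hy : ∀ i, |y i| ≤ R) (i : Fin d) : |((D.gram φ h)⁻¹ *ᵥ y) i| ≤ d * R := by
  have h1 := Matrix.abs_dotProduct_le_sum _ y zero_le_one
    ((gram_posDef φ D h).abs_inv_apply_le (dotProduct_self_le_gram φ D h) i) hy
  rwa [one_mul] at h1

lemma abs_sum_feature_mul_le {φ : S × A × B → EuclideanSpace ℝ (Fin d)} (hφ : ∀ z, ‖φ z‖ ≤ 1)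
    (D : Dataset S A B H K) (h : Fin H) {y : Fin K → ℝ} {R : ℝ} (hy : ∀ τ, |y τ| ≤ R) (i : Fin d) :
    |∑ τ, φ (D.triple h τ) i * y τ| ≤ K * R := by
  refine (Finset.abs_sum_le_sum_abs _ _).trans ?_
  refine (Finset.sum_le_sum (g := fun _ => R) fun τ _ => ?_).trans (by simp)
  rw [abs_mul, ← one_mul R]
  exact mul_le_mul ((EuclideanSpace.abs_apply_le_norm _ i).trans (hφ _)) (hy τ) (abs_nonneg _)
    zero_le_one

end Dataset

/-! ### Integration of bounded measurable functions. -/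

/-- Bounded measurable real functions. -/
def BoundedMeasurable {X : Type*} [MeasurableSpace X] (f : X → ℝ) : Prop :=
  Measurable f ∧ ∃ C : ℝ, ∀ x, |f x| ≤ C

namespace BoundedMeasurable

variable {X Y : Type*} [MeasurableSpace X] [MeasurableSpace Y] {f g : X → ℝ}

lemma integrable (hf : BoundedMeasurable f) (μ : Measure X) [IsFiniteMeasure μ] :
    Integrable f μ :=
  let ⟨C, hC⟩ := hf.2
  .of_bound hf.1.aestronglyMeasurable C (.of_forall hC)

lemma add (hf : BoundedMeasurable f) (hg : BoundedMeasurable g) :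
    BoundedMeasurable fun x => f x + g x :=
  let ⟨C, hC⟩ := hf.2
  let ⟨C', hC'⟩ := hg.2
  ⟨hf.1.add hg.1, C + C', fun x => (abs_add_le _ _).trans (add_le_add (hC x) (hC' x))⟩

lemma const_mul (hf : BoundedMeasurable f) (c : ℝ) : BoundedMeasurable fun x => c * f x :=
  let ⟨C, hC⟩ := hf.2
  ⟨hf.1.const_mul c, |c| * C, fun x => by
    rw [abs_mul]; exact mul_le_mul_of_nonneg_left (hC x) (abs_nonneg c)⟩

lemma neg (hf : BoundedMeasurable f) : BoundedMeasurable fun x => -f x := by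
  simpa using hf.const_mul (-1)

lemma comp (hf : BoundedMeasurable f) {e : Y → X} (he : Measurable e) :
    BoundedMeasurable fun y => f (e y) :=
  let ⟨C, hC⟩ := hf.2
  ⟨hf.1.comp he, C, fun y => hC (e y)⟩

lemma of_mem_Icc (hf : Measurable f) {a b : ℝ} (h : ∀ x, f x ∈ Set.Icc a b) :
    BoundedMeasurable f :=
  ⟨hf, max |a| |b|, fun x => abs_le_max_abs_abs (h x).1 (h x).2⟩

lemma integral_kernel (hf : BoundedMeasurable f) (κ : Kernel Y X) [IsMarkovKernel κ] :
    BoundedMeasurable fun y => ∫ x, f x ∂κ y := by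
  obtain ⟨C, hC⟩ := hf.2
  refine ⟨(hf.1.stronglyMeasurable.integral_kernel (κ := κ)).measurable, C, fun y => ?_⟩
  simpa using norm_integral_le_of_norm_le_const (μ := κ y) (f := f) (.of_forall hC)

end BoundedMeasurable

lemma integral_mem_Icc {X : Type*} [MeasurableSpace X] {f : X → ℝ} (hf : Measurable f)
    (μ : Measure X) [IsProbabilityMeasure μ] {a b : ℝ} (h : ∀ x, f x ∈ Set.Icc a b) :
    ∫ x, f x ∂μ ∈ Set.Icc a b := by
  have hi := (BoundedMeasurable.of_mem_Icc hf h).integrable μ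
  constructor
  · simpa using integral_mono (integrable_const a) hi fun x => (h x).1
  · simpa using integral_mono hi (integrable_const b) fun x => (h x).2

lemma matrixPayoff_mem_Icc {A B : Type*} [MeasurableSpace A] [DiscreteMeasurableSpace A]
    [MeasurableSpace B] [DiscreteMeasurableSpace B] {Q : A → B → ℝ} {a b : ℝ}
    (h : ∀ x y, Q x y ∈ Set.Icc a b)
    (p : Measure A) (q : Measure B) [IsProbabilityMeasure p] [IsProbabilityMeasure q] :
    matrixPayoff Q p q ∈ Set.Icc a b :=
  integral_mem_Icc .of_discrete _ fun x => integral_mem_Icc .of_discrete _ (h x)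

/-! ### Values of matrix games. -/

section MatrixGame

variable {A B : Type*} [Finite A] [MeasurableSpace A] [DiscreteMeasurableSpace A]
  [Finite B] [MeasurableSpace B] [DiscreteMeasurableSpace B]

lemma matrixPayoff_mono {Q Q' : A → B → ℝ} (h : ∀ a b, Q a b ≤ Q' a b) (p : Measure A)
    (q : Measure B) [IsFiniteMeasure p] [IsFiniteMeasure q] :
    matrixPayoff Q p q ≤ matrixPayoff Q' p q :=
  integral_mono .of_finite .of_finite fun a => integral_mono .of_finite .of_finite (h a)

lemma matrixPayoff_add_const (Q : A → B → ℝ) (c : ℝ) (p : Measure A)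
    (q : Measure B) [IsProbabilityMeasure p] [IsProbabilityMeasure q] :
    matrixPayoff (fun a b => Q a b + c) p q = matrixPayoff Q p q + c := by
  simp only [matrixPayoff]
  simp only [integral_add (Integrable.of_finite (μ := q)) (integrable_const c),
    integral_add (Integrable.of_finite (μ := p)) (integrable_const _), integral_const,
    probReal_univ, one_smul]

/-- Playing `p` against `q'` compares the two equilibria. So the value of a matrix game is
1-Lipschitz in the sup norm, whichever equilibria are selected. -/
lemma IsMatrixNash.payoff_le_add {Q Q' : A → B → ℝ} {c : ℝ} (h : ∀ a b, Q a b ≤ Q' a b + c)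
    {p p' : Measure A} {q q' : Measure B} [IsProbabilityMeasure p] [IsProbabilityMeasure p']
    [IsProbabilityMeasure q] [IsProbabilityMeasure q'] (hN : IsMatrixNash Q p q)
    (hN' : IsMatrixNash Q' p' q') : matrixPayoff Q p q ≤ matrixPayoff Q' p' q' + c := calc
  _ ≤ matrixPayoff Q p q' := hN.2 q' ‹_›
  _ ≤ matrixPayoff (fun a b => Q' a b + c) p q' := matrixPayoff_mono h _ _
  _ = matrixPayoff Q' p q' + c := matrixPayoff_add_const _ _ _ _
  _ ≤ _ := by gcongr; exact hN'.1 p ‹_›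

end MatrixGame

/-! ### Bellman inequalities and telescoping along trajectories. -/

instance {S A : Type*} [MeasurableSpace S] [MeasurableSpace A] {H : ℕ} (π : Policy S A H)
    (h : Fin H) : IsMarkovKernel (π.act h) := π.markov_act h

namespace MarkovGame

variable {S A B : Type*} [MeasurableSpace S] [MeasurableSpace A] [MeasurableSpace B] {H : ℕ}

instance (M : MarkovGame S A B H) (h : Fin H) : IsMarkovKernel (M.trans h) := M.markov_trans h

instance (π : Policy S A H) (ν : Policy S B H) (k : Fin H) :
    IsMarkovKernel (playKernel π ν k) := by
  unfold playKernel; infer_instance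

lemma stateLaw_zero (M : MarkovGame S A B H) (π : Policy S A H) (ν : Policy S B H) :
    M.stateLaw π ν 0 0 = Kernel.id := rfl

lemma stateLaw_succ (M : MarkovGame S A B H) (π : Policy S A H) (ν : Policy S B H) (k : Fin H) :
    M.stateLaw π ν 0 k.succ =
      M.trans k ∘ₖ (playKernel π ν k ∘ₖ M.stateLaw π ν 0 k.castSucc) := by
  simp [stateLaw]

instance (M : MarkovGame S A B H) (π : Policy S A H) (ν : Policy S B H) (k : Fin (H + 1)) :
    IsMarkovKernel (M.stateLaw π ν 0 k) := by
  induction k using Fin.induction with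
  | zero => rw [stateLaw_zero]; infer_instance
  | succ k ih => rw [stateLaw_succ]; infer_instance

lemma reward_bddMeas (M : MarkovGame S A B H) (h : Fin H) : BoundedMeasurable (M.reward h) :=
  .of_mem_Icc (M.measurable_reward h) (M.reward_mem h)

lemma value_zero (M : MarkovGame S A B H) (π : Policy S A H) (ν : Policy S B H) (x : S) :
    M.value π ν 0 x = ∑ k, M.expect π ν 0 x k (M.reward k) := by
  simp [value]

lemma expect_add (M : MarkovGame S A B H) (π : Policy S A H) (ν : Policy S B H) (x : S)
    (k : Fin H) {f g : S × A × B → ℝ} (hf : BoundedMeasurable f) (hg : BoundedMeasurable g) :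
    M.expect π ν 0 x k (fun z => f z + g z) = M.expect π ν 0 x k f + M.expect π ν 0 x k g :=
  integral_add (hf.integrable _) (hg.integrable _)

lemma expect_const_mul (M : MarkovGame S A B H) (π : Policy S A H) (ν : Policy S B H)
    (h : Fin (H + 1)) (x : S) (k : Fin H) (c : ℝ) (f : S × A × B → ℝ) :
    M.expect π ν h x k (fun z => c * f z) = c * M.expect π ν h x k f :=
  integral_const_mul _ _

lemma integral_playKernel (π : Policy S A H) (ν : Policy S B H) (k : Fin H) (s : S)
    {g : S × A × B → ℝ} (hg : BoundedMeasurable g) :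
    ∫ z, g z ∂playKernel π ν k s =
      matrixPayoff (fun a b => g (s, a, b)) (π.act k s) (ν.act k s) := by
  rw [playKernel, Kernel.prod_apply, Kernel.prod_apply, Kernel.id_apply,
    integral_prod _ (hg.integrable _), integral_dirac' _ _
      (StronglyMeasurable.integral_prod_right' hg.1.stronglyMeasurable),
    integral_prod _ ((hg.comp measurable_prodMk_left).integrable _)]
  rfl

/-- If `U` satisfies the one-step Bellman inequality with running payoff `f`, then `U` is at
most the expected total payoff. -/
lemma le_sum_expect (M : MarkovGame S A B H) (π : Policy S A H) (ν : Policy S B H) (x : S)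
    {U : Fin (H + 1) → S → ℝ} {f : Fin H → S × A × B → ℝ}
    (hU : ∀ k, BoundedMeasurable (U k)) (hf : ∀ k, BoundedMeasurable (f k))
    (hlast : ∀ s, U (Fin.last H) s = 0)
    (hstep : ∀ k s, U k.castSucc s ≤
      matrixPayoff (fun a b => f k (s, a, b) + ∫ s', U k.succ s' ∂M.trans k (s, a, b))
        (π.act k s) (ν.act k s)) :
    U 0 x ≤ ∑ k, M.expect π ν 0 x k (f k) := by
  -- `a k` is the mean of `U k` at the state of index `k`. The differences telescope from `U 0 x` to
  -- `0`, and each is bounded by the one-step inequality.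
  set a : Fin (H + 1) → ℝ := fun k => ∫ s, U k s ∂M.stateLaw π ν 0 k x with ha
  have hP : ∀ k : Fin H, BoundedMeasurable fun z => ∫ s', U k.succ s' ∂M.trans k z :=
    fun k => (hU k.succ).integral_kernel _
  have key : ∀ k : Fin H, a k.castSucc - a k.succ ≤ M.expect π ν 0 x k (f k) := by
    intro k
    have h1 : a k.succ = ∫ z, ∫ s', U k.succ s' ∂M.trans k z
        ∂(playKernel π ν k ∘ₖ M.stateLaw π ν 0 k.castSucc) x := by
      rw [ha]
      simp only [stateLaw_succ]
      rw [Kernel.integral_comp ((hU k.succ).integrable _)]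
    rw [sub_le_iff_le_add, h1, expect, ← integral_add ((hf k).integrable _) ((hP k).integrable _)]
    have hs := (hf k).add (hP k)
    rw [Kernel.integral_comp (hs.integrable _)]
    refine integral_mono ((hU _).integrable _) ((hs.integral_kernel _).integrable _) fun s => ?_
    simp only [integral_playKernel π ν k s hs]
    exact hstep k s
  have hsum : ∑ k : Fin H, (a k.castSucc - a k.succ) = a 0 - a (Fin.last H) := by
    rw [Finset.sum_sub_distrib]
    have h1 := Fin.sum_univ_castSucc a
    have h2 := Fin.sum_univ_succ a
    linarith
  have h0 : a 0 = U 0 x := by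
    simp only [ha, stateLaw_zero, Kernel.id_apply]
    exact integral_dirac' _ _ (hU 0).1.stronglyMeasurable
  have hl : a (Fin.last H) = 0 := by simp [ha, hlast]
  calc U 0 x = ∑ k : Fin H, (a k.castSucc - a k.succ) := by rw [hsum, h0, hl, sub_zero]
    _ ≤ _ := Finset.sum_le_sum fun k _ => key k

lemma le_value_add (M : MarkovGame S A B H) (π : Policy S A H) (ν : Policy S B H) (x : S)
    {U : Fin (H + 1) → S → ℝ} {g : Fin H → S × A × B → ℝ}
    (hU : ∀ k, BoundedMeasurable (U k)) (hg : ∀ k, BoundedMeasurable (g k))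
    (hlast : ∀ s, U (Fin.last H) s = 0)
    (hstep : ∀ k s, U k.castSucc s ≤
      matrixPayoff (fun a b => (M.reward k (s, a, b) + ∫ s', U k.succ s' ∂M.trans k (s, a, b)) +
        g k (s, a, b)) (π.act k s) (ν.act k s)) :
    U 0 x ≤ M.value π ν 0 x + ∑ k, M.expect π ν 0 x k (g k) := by
  have h := M.le_sum_expect π ν x hU (fun k => (M.reward_bddMeas k).add (hg k)) hlast
    fun k s => (hstep k s).trans_eq (by simp only [add_right_comm])
  simpa only [M.expect_add π ν x _ (M.reward_bddMeas _) (hg _), Finset.sum_add_distrib,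
    value_zero] using h

lemma value_le_add (M : MarkovGame S A B H) (π : Policy S A H) (ν : Policy S B H) (x : S)
    {U : Fin (H + 1) → S → ℝ} {g : Fin H → S × A × B → ℝ}
    (hU : ∀ k, BoundedMeasurable (U k)) (hg : ∀ k, BoundedMeasurable (g k))
    (hlast : ∀ s, U (Fin.last H) s = 0)
    (hstep : ∀ k s,
      matrixPayoff (fun a b => (M.reward k (s, a, b) + ∫ s', U k.succ s' ∂M.trans k (s, a, b)) -
        g k (s, a, b)) (π.act k s) (ν.act k s) ≤ U k.castSucc s) :
    M.value π ν 0 x ≤ U 0 x + ∑ k, M.expect π ν 0 x k (g k) := by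
  -- Negating `U` and the reward reverses the Bellman inequality.
  have h := M.le_sum_expect π ν x (U := fun k s => -U k s)
    (f := fun k z => -1 * M.reward k z + g k z) (fun k => (hU k).neg)
    (fun k => ((M.reward_bddMeas k).const_mul _).add (hg k)) (by simpa using hlast) fun k s => by
      refine (neg_le_neg (hstep k s)).trans_eq ?_
      simp only [matrixPayoff]
      rw [← integral_neg]
      simp only [← integral_neg (f := fun _ : B => _)]
      congr 1 with a
      congr 1 with b
      rw [integral_neg]
      ring
  simp only [M.expect_add π ν x _ ((M.reward_bddMeas _).const_mul _) (hg _),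
    expect_const_mul, Finset.sum_add_distrib, ← Finset.mul_sum] at h
  rw [value_zero]
  linarith

end MarkovGame

/-! ### Conditional laws of the data and the exponential supermartingale. -/

/-- If the conditional law of `Y` given `m` is `κ (W ·)` with an `m`-measurable `W`, then the
joint law of `(W, Y)` is the composition-product of the law of `W` with `κ`. -/
lemma map_prodMk_eq_compProd_of_condExp {Ω T E : Type*} {m : MeasurableSpace Ω}
    [m0 : MeasurableSpace Ω] [MeasurableSpace T] [MeasurableSpace E] (hm : m ≤ m0)
    (P : Measure Ω) [IsProbabilityMeasure P] {Y : Ω → E} (hY : Measurable Y) {W : Ω → T}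
    (hW : Measurable[m] W) (κ : Kernel T E) [IsMarkovKernel κ]
    (hκ : ∀ s, MeasurableSet s → P⟦Y ⁻¹' s | m⟧ =ᵐ[P] fun ω => (κ (W ω)).real s) :
    P.map (fun ω => (W ω, Y ω)) = (P.map W) ⊗ₘ κ := by
  have hW0 : Measurable W := hW.mono hm le_rfl
  have := Measure.isProbabilityMeasure_map (μ := P) hW0.aemeasurable
  have := Measure.isProbabilityMeasure_map (μ := P) (hW0.prodMk hY).aemeasurable
  refine Measure.ext_prod fun {s t} hs ht => ?_
  rw [Measure.map_apply (hW0.prodMk hY) (hs.prod ht), Measure.compProd_apply_prod hs ht,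
    setLIntegral_map hs (κ.measurable_coe ht) hW0]
  have hset : (fun ω => (W ω, Y ω)) ⁻¹' s ×ˢ t = Y ⁻¹' t ∩ W ⁻¹' s := by
    ext ω; simp [and_comm]
  have h1 := setIntegral_condExp (μ := P) hm (f := (Y ⁻¹' t).indicator fun _ => (1 : ℝ))
    ((integrable_const _).indicator (hY ht)) (hW hs)
  rw [setIntegral_congr_ae (hW0 hs) ((hκ t ht).mono fun ω h _ => h),
    setIntegral_indicator (hY ht)] at h1
  rw [hset, Set.inter_comm, ← ofReal_measureReal]
  have h2 : P.real (W ⁻¹' s ∩ Y ⁻¹' t) = ∫ ω in W ⁻¹' s, (κ (W ω)).real t ∂P := by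
    rw [h1]; simp
  rw [h2, ofReal_integral_eq_lintegral_ofReal]
  · exact lintegral_congr fun ω => ofReal_measureReal
  · refine Integrable.of_bound ?_ 1 (.of_forall fun ω => ?_)
    · exact ((κ.measurable_coe ht).comp hW0).ennreal_toReal.aestronglyMeasurable
    · rw [Real.norm_of_nonneg measureReal_nonneg]; exact measureReal_le_one
  · exact .of_forall fun ω => measureReal_nonneg

/-- Hoeffding's lemma in the form of a bounded exponential moment. -/
lemma lintegral_exp_le_one_of_mem_Icc {X : Type*} [MeasurableSpace X] (μ : Measure X)
    [IsProbabilityMeasure μ] {V : X → ℝ} (hV : Measurable V) {R : ℝ}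
    (hVR : ∀ x, V x ∈ Set.Icc 0 R) (a : ℝ) :
    ∫⁻ x, ENNReal.ofReal (Real.exp (a * (V x - ∫ y, V y ∂μ) - R ^ 2 / 2 * a ^ 2)) ∂μ ≤ 1 := by
  have h := hasSubgaussianMGF_of_mem_Icc (μ := μ) hV.aemeasurable (.of_forall hVR)
  have h1 := h.mgf_le a
  rw [mgf] at h1
  rw [← ofReal_integral_eq_lintegral_ofReal _ (.of_forall fun _ => (Real.exp_pos _).le)]
  · rw [ENNReal.ofReal_le_one]
    simp only [Real.exp_sub, integral_div]
    rw [div_le_one (Real.exp_pos _)]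
    -- Hoeffding's lemma gives `R² a² / 8`; the weaker `R² a² / 2` is all that is used.
    refine h1.trans (Real.exp_le_exp.mpr ?_)
    simp only [sub_zero, NNReal.coe_pow, NNReal.coe_div, coe_nnnorm, Real.norm_eq_abs,
      NNReal.coe_ofNat, div_pow, sq_abs]
    nlinarith [mul_nonneg (sq_nonneg R) (sq_nonneg a)]
  · simp only [Real.exp_sub]
    exact (h.integrable_exp_mul a).div_const _

namespace Dataset

variable {S A B Ω : Type*} [MeasurableSpace S] [MeasurableSpace A] [MeasurableSpace B]
  {m0 : MeasurableSpace Ω} {H K : ℕ}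

/-- The deviation of `V(s_{h+1}^τ)` from its conditional mean. -/
noncomputable def noise (M : MarkovGame S A B H) (D : Dataset S A B H K) (h : Fin H) (V : S → ℝ)
    (τ : Fin K) : ℝ :=
  V (D.state h.succ τ) - ∫ s, V s ∂M.trans h (D.triple h τ)

variable {P : Measure Ω} {M : MarkovGame S A B H} {D : Ω → Dataset S A B H K}

namespace IsCompliant

lemma measurable_triple (hD : IsCompliant P M D) (h : Fin H) (τ : Fin K) :
    Measurable fun ω => (D ω).triple h τ :=
  (hD.measurable_state _ τ).prodMk ((hD.measurable_act₁ h τ).prodMk (hD.measurable_act₂ h τ))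

lemma measurable_outcome (hD : IsCompliant P M D) (h : Fin H) (τ : Fin K) :
    Measurable fun ω => (D ω).outcome h τ :=
  (hD.measurable_rew h τ).prodMk (hD.measurable_state _ τ)

lemma history_le (hD : IsCompliant P M D) (h : Fin H) (τ : Fin K) : history D h τ ≤ m0 :=
  sup_le (iSup₂_le fun i _ => (hD.measurable_triple h i).comap_le)
    (iSup₂_le fun i _ => (hD.measurable_outcome h i).comap_le)

end IsCompliant

lemma measurable_triple_history (D : Ω → Dataset S A B H K) (h : Fin H) {i τ : Fin K}
    (hi : i ≤ τ) : Measurable[history D h τ] fun ω => (D ω).triple h i :=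
  (comap_measurable _).mono (le_sup_of_le_left (le_iSup₂ (f := fun i (_ : i ∈ Set.Iic τ) =>
    MeasurableSpace.comap (fun ω => (D ω).triple h i) inferInstance) i hi)) le_rfl

lemma measurable_outcome_history (D : Ω → Dataset S A B H K) (h : Fin H) {i τ : Fin K}
    (hi : i < τ) : Measurable[history D h τ] fun ω => (D ω).outcome h i :=
  (comap_measurable _).mono (le_sup_of_le_right (le_iSup₂ (f := fun i (_ : i ∈ Set.Iio τ) =>
    MeasurableSpace.comap (fun ω => (D ω).outcome h i) inferInstance) i hi)) le_rfl

lemma measurable_increment (M : MarkovGame S A B H) (h : Fin H) {V : S → ℝ} (hV : Measurable V)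
    {g : S × A × B → ℝ} (hg : Measurable g) (c : ℝ) :
    Measurable fun y : (S × A × B) × S =>
      g y.1 * (V y.2 - ∫ s, V s ∂M.trans h y.1) - c * g y.1 ^ 2 := by
  have hPV : Measurable fun z => ∫ s, V s ∂M.trans h z :=
    (hV.stronglyMeasurable.integral_kernel (κ := M.trans h)).measurable
  exact ((hg.comp measurable_fst).mul ((hV.comp measurable_snd).sub (hPV.comp measurable_fst))).sub
    (((hg.comp measurable_fst).pow_const 2).const_mul _)

variable [IsProbabilityMeasure P]

/-- Integration of a function of history variables `L`, the triple and the outcome. -/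
lemma IsCompliant.lintegral_outcome (hD : IsCompliant P M D) (h : Fin H) (τ : Fin K)
    {L : Ω → ℝ} (hL : Measurable[history D h τ] L)
    {F : (ℝ × S × A × B) × ℝ × S → ℝ≥0∞} (hF : Measurable F) :
    ∫⁻ ω, F ((L ω, (D ω).triple h τ), (D ω).outcome h τ) ∂P =
      ∫⁻ ω, ∫⁻ s, F ((L ω, (D ω).triple h τ), (M.reward h ((D ω).triple h τ), s))
        ∂M.trans h ((D ω).triple h τ) ∂P := by
  -- The real coordinate carries the past through `L`; compliance makes the conditional law depend
  -- on the triple alone.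
  let κ : Kernel (ℝ × S × A × B) (ℝ × S) :=
    (Kernel.deterministic (M.reward h) (M.measurable_reward h) ×ₖ M.trans h).comap Prod.snd
      measurable_snd
  have hκ : ∀ w, κ w = (Measure.dirac (M.reward h w.2)).prod (M.trans h w.2) := fun w => by
    rw [Kernel.comap_apply, Kernel.prod_apply, Kernel.deterministic_apply]
  have hW := hL.prodMk (measurable_triple_history D h (le_refl τ))
  have hW0 := hW.mono (hD.history_le h τ) le_rfl
  have key := map_prodMk_eq_compProd_of_condExp (hD.history_le h τ) P
    (hD.measurable_outcome h τ) hW κ fun s hs => by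
      simpa only [hκ] using hD.condLaw h τ s hs
  have := Measure.isProbabilityMeasure_map (μ := P) hW0.aemeasurable
  rw [← lintegral_map hF (hW0.prodMk (hD.measurable_outcome h τ)), key,
    Measure.lintegral_compProd hF, lintegral_map hF.lintegral_kernel_prod_right' hW0]
  refine lintegral_congr fun ω => ?_
  have hF' : Measurable fun b => F ((L ω, (D ω).triple h τ), b) := hF.comp measurable_prodMk_left
  rw [hκ, lintegral_prod _ hF'.aemeasurable, lintegral_dirac' _ hF'.lintegral_prod_right']

lemma IsCompliant.ae_rew_eq (hD : IsCompliant P M D) :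
    ∀ᵐ ω ∂P, ∀ h τ, (D ω).rew h τ = M.reward h ((D ω).triple h τ) := by
  refine ae_all_iff.mpr fun h => ae_all_iff.mpr fun τ => ?_
  -- Testing the conditional law on the distance from the observed to the prescribed reward gives
  -- zero mean, hence equality almost surely.
  have hF : Measurable fun y : (ℝ × S × A × B) × ℝ × S =>
      ENNReal.ofReal |y.2.1 - M.reward h y.1.2| := by
    have := M.measurable_reward h
    fun_prop
  have key := hD.lintegral_outcome h τ (L := fun _ => 0) measurable_const hF
  simp only [sub_self, abs_zero, ENNReal.ofReal_zero, lintegral_zero] at key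
  have hT := hD.measurable_triple h τ
  have hO := hD.measurable_outcome h τ
  filter_upwards [(lintegral_eq_zero_iff (hF.comp ((measurable_const (a := (0 : ℝ)).prodMk
    hT).prodMk hO))).mp key] with ω hω
  simpa [sub_eq_zero, outcome] using hω

/-- The exponential supermartingale of the noise in direction `v`. -/
lemma IsCompliant.lintegral_exp_noise_le_one (hD : IsCompliant P M D) (h : Fin H)
    {V : S → ℝ} (hV : Measurable V) {R : ℝ} (hVR : ∀ s, V s ∈ Set.Icc 0 R)
    {g : S × A × B → ℝ} (hg : Measurable g) (t : ℕ) (ht : t ≤ K) :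
    ∫⁻ ω, ENNReal.ofReal (Real.exp (∑ τ : Fin K with τ.val < t,
      (g ((D ω).triple h τ) * (D ω).noise M h V τ
        - R ^ 2 / 2 * g ((D ω).triple h τ) ^ 2))) ∂P ≤ 1 := by
  induction t with
  | zero => simp
  | succ t ih =>
    refine le_trans ?_ (ih (by omega))
    let j : Fin K := ⟨t, by omega⟩
    set L : Ω → ℝ := fun ω => ∑ τ : Fin K with τ.val < t,
      (g ((D ω).triple h τ) * (D ω).noise M h V τ
        - R ^ 2 / 2 * g ((D ω).triple h τ) ^ 2) with hLdef
    have hL : Measurable[history D h j] L := by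
      refine Finset.measurable_fun_sum _ fun τ hτ => ?_
      have hlt : τ < j := (Finset.mem_filter.mp hτ).2
      have h1 := measurable_triple_history D h hlt.le
      have h2 := measurable_outcome_history D h hlt
      exact (measurable_increment M h hV hg _).comp (h1.prodMk h2.snd)
    have hsum : ∀ ω, ∑ τ : Fin K with τ.val < t + 1,
        (g ((D ω).triple h τ) * (D ω).noise M h V τ - R ^ 2 / 2 * g ((D ω).triple h τ) ^ 2) =
        L ω + (g ((D ω).triple h j) * (V ((D ω).outcome h j).2
          - ∫ s, V s ∂M.trans h ((D ω).triple h j)) - R ^ 2 / 2 * g ((D ω).triple h j) ^ 2) := by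
      intro ω
      have : (Finset.univ.filter fun τ : Fin K => τ.val < t + 1) =
          insert j (Finset.univ.filter fun τ : Fin K => τ.val < t) := by
        ext τ
        simp only [Finset.mem_filter, Finset.mem_univ, true_and, Finset.mem_insert, Fin.ext_iff, j]
        omega
      rw [this, Finset.sum_insert (by simp [j]), add_comm]
      rfl
    let F : (ℝ × S × A × B) × ℝ × S → ℝ≥0∞ := fun y =>
      ENNReal.ofReal (Real.exp (y.1.1 + (g y.1.2 * (V y.2.2 - ∫ s, V s ∂M.trans h y.1.2)
        - R ^ 2 / 2 * g y.1.2 ^ 2)))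
    have hF : Measurable F := ((measurable_fst.comp measurable_fst).add
      ((measurable_increment M h hV hg _).comp ((measurable_snd.comp measurable_fst).prodMk
        (measurable_snd.comp measurable_snd)))).exp.ennreal_ofReal
    simp only [hsum]
    -- Given the history, `L` is constant and the new factor has conditional mean at most one, so
    -- the last trajectory can be dropped.
    refine (hD.lintegral_outcome h j hL hF).trans_le (lintegral_mono fun ω => ?_)
    simp only [F, Real.exp_add, ENNReal.ofReal_mul (Real.exp_pos _).le]
    rw [lintegral_const_mul _ (by fun_prop)]
    exact mul_le_of_le_one_right' (lintegral_exp_le_one_of_mem_Icc _ hV hVR _)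

/-- Markov's inequality for the supermartingale at its final time. -/
lemma IsCompliant.measure_noise_ge_le (hD : IsCompliant P M D) (h : Fin H)
    {V : S → ℝ} (hV : Measurable V) {R : ℝ} (hVR : ∀ s, V s ∈ Set.Icc 0 R)
    {g : S × A × B → ℝ} (hg : Measurable g) (ℓ : ℝ) :
    P.real {ω | ℓ ≤ ∑ τ, (g ((D ω).triple h τ) * (D ω).noise M h V τ
      - R ^ 2 / 2 * g ((D ω).triple h τ) ^ 2)} ≤ Real.exp (-ℓ) := by
  have h1 := hD.lintegral_exp_noise_le_one h hV hVR hg K le_rfl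
  simp only [Fin.is_lt, Finset.filter_true] at h1
  have hm : Measurable fun ω => ∑ τ, (g ((D ω).triple h τ) * (D ω).noise M h V τ
      - R ^ 2 / 2 * g ((D ω).triple h τ) ^ 2) := by
    exact Finset.measurable_fun_sum _ fun τ _ => (measurable_increment M h hV hg _).comp
      ((hD.measurable_triple h τ).prodMk (hD.measurable_state h.succ τ))
  have h2 := mul_meas_ge_le_lintegral (μ := P) hm.exp.ennreal_ofReal (ENNReal.ofReal (Real.exp ℓ))
  simp only [ENNReal.ofReal_le_ofReal_iff (Real.exp_pos _).le, Real.exp_le_exp] at h2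
  rw [Real.exp_neg, ← one_div, le_div_iff₀ (Real.exp_pos ℓ), mul_comm]
  have h3 := ENNReal.toReal_mono ENNReal.one_ne_top (h2.trans h1)
  rwa [ENNReal.toReal_mul, ENNReal.toReal_ofReal (Real.exp_pos _).le, ENNReal.toReal_one] at h3

end Dataset

/-! ### Truncated payoffs and their stability in the parameters. -/

lemma regulate_mem_Icc (m : ℕ) (x : ℝ) : regulate m x ∈ Set.Icc (0 : ℝ) m :=
  ⟨le_min (Nat.cast_nonneg m) (le_max_right _ _), min_le_left _ _⟩

lemma regulate_le_add (m : ℕ) {x y e : ℝ} (h : x ≤ y + e) (he : 0 ≤ e) :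
    regulate m x ≤ regulate m y + e := by
  unfold regulate
  rw [← min_add_add_right, ← max_add_add_right]
  exact min_le_min (by linarith) (max_le_max h (by linarith))

lemma measurable_regulate (m : ℕ) : Measurable (regulate m) := by
  unfold regulate; fun_prop

/-- No sign of `a` or `b` is needed, since `√` vanishes on negative numbers. The matrices in the net
are not assumed semidefinite, so their quadratic forms may be negative. -/
lemma Real.sqrt_le_sqrt_add_sqrt_of_le_add {a b c : ℝ} (h : a ≤ b + c) (hc : 0 ≤ c) :
    √a ≤ √b + √c := by
  rw [Real.sqrt_le_left (by positivity)]
  have hb : b ≤ √b ^ 2 := by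
    rw [Real.sq_sqrt']
    exact le_max_left _ _
  nlinarith [Real.sq_sqrt hc, mul_nonneg (Real.sqrt_nonneg b) (Real.sqrt_nonneg c)]

section Estimate

variable {S A B : Type*} {d : ℕ}

/-- The truncated payoff `Π_m(φᵀw + b √(φᵀGφ))`. -/
noncomputable def payoffEstimate (φ : S × A × B → EuclideanSpace ℝ (Fin d)) (b : ℝ) (m : ℕ)
    (w : Fin d → ℝ) (G : Matrix (Fin d) (Fin d) ℝ) (s : S) (x : A) (y : B) : ℝ :=
  regulate m ((φ (s, x, y)).ofLp ⬝ᵥ w + b * √((φ (s, x, y)).ofLp ⬝ᵥ G *ᵥ (φ (s, x, y)).ofLp))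

/-- The bonus is only 1/2-Hölder in the matrix `G`, whence the term `√η`; truncation does not
enlarge differences. -/
lemma payoffEstimate_le_add {φ : S × A × B → EuclideanSpace ℝ (Fin d)} (hφ : ∀ z, ‖φ z‖ ≤ 1)
    (b : ℝ) (m : ℕ) {w w' : Fin d → ℝ} {G G' : Matrix (Fin d) (Fin d) ℝ} {η : ℝ}
    (hw : ∀ i, |w i - w' i| ≤ η) (hG : ∀ i j, |G i j - G' i j| ≤ η) (hη : 0 ≤ η)
    (s : S) (x : A) (y : B) :
    payoffEstimate φ b m w G s x y ≤
      payoffEstimate φ b m w' G' s x y + (d * η + |b| * (d * √η)) := by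
  set u := (φ (s, x, y)).ofLp with hu
  have hu1 : ∀ i, |u i| ≤ 1 := fun i =>
    (EuclideanSpace.abs_apply_le_norm _ i).trans (hφ _)
  have h1 : |u ⬝ᵥ (w - w')| ≤ d * (1 * η) := Matrix.abs_dotProduct_le_sum _ _ zero_le_one hu1 hw
  have hquad : ∀ Δ : Matrix (Fin d) (Fin d) ℝ, (∀ i j, |Δ i j| ≤ η) →
      u ⬝ᵥ Δ *ᵥ u ≤ (d * √η) ^ 2 := by
    intro Δ hΔ
    refine (le_abs_self _).trans ((Matrix.abs_dotProduct_le_sum _ _ zero_le_one hu1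
      (b := d * (η * 1)) fun i => ?_).trans_eq ?_)
    · exact Matrix.abs_dotProduct_le_sum _ _ hη (hΔ i) hu1
    · rw [mul_pow, Real.sq_sqrt hη]; ring
  have hd : 0 ≤ (d : ℝ) * √η := by positivity
  have hsq : |√(u ⬝ᵥ G *ᵥ u) - √(u ⬝ᵥ G' *ᵥ u)| ≤ d * √η := by
    rw [abs_le, ← Real.sqrt_sq hd]
    constructor
    · have := Real.sqrt_le_sqrt_add_sqrt_of_le_add (a := u ⬝ᵥ G' *ᵥ u) (b := u ⬝ᵥ G *ᵥ u)
        (c := (d * √η) ^ 2) (by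
          have h := hquad (G' - G) fun i j => by rw [Matrix.sub_apply, abs_sub_comm]; exact hG i j
          rw [Matrix.sub_mulVec, dotProduct_sub] at h
          linarith) (sq_nonneg _)
      linarith
    · have := Real.sqrt_le_sqrt_add_sqrt_of_le_add (a := u ⬝ᵥ G *ᵥ u) (b := u ⬝ᵥ G' *ᵥ u)
        (c := (d * √η) ^ 2) (by
          have h := hquad (G - G') fun i j => hG i j
          rw [Matrix.sub_mulVec, dotProduct_sub] at h
          linarith) (sq_nonneg _)
      linarith
  refine regulate_le_add m ?_ (by positivity)
  have h2 : |b * (√(u ⬝ᵥ G *ᵥ u) - √(u ⬝ᵥ G' *ᵥ u))| ≤ |b| * (d * √η) := by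
    rw [abs_mul]
    exact mul_le_mul_of_nonneg_left hsq (abs_nonneg _)
  rw [dotProduct_sub] at h1
  have h3 := (le_abs_self _).trans h1
  have h4 := (le_abs_self _).trans h2
  rw [mul_sub] at h4
  linarith

variable [MeasurableSpace S] [MeasurableSpace A] [MeasurableSpace B]

/-- `V` is the value function of the matrix games with payoffs `payoffEstimate φ b m w G`. -/
structure IsNashEstimate (φ : S × A × B → EuclideanSpace ℝ (Fin d)) (b : ℝ) (m : ℕ) (V : S → ℝ)
    (w : Fin d → ℝ) (G : Matrix (Fin d) (Fin d) ℝ) : Prop where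
  measurable : Measurable V
  nash : ∀ s, ∃ (p : Measure A) (q : Measure B), IsProbabilityMeasure p ∧ IsProbabilityMeasure q ∧
    IsMatrixNash (payoffEstimate φ b m w G s) p q ∧
    V s = matrixPayoff (payoffEstimate φ b m w G s) p q

variable [DiscreteMeasurableSpace A] [DiscreteMeasurableSpace B]

lemma IsNashEstimate.mem_Icc {φ : S × A × B → EuclideanSpace ℝ (Fin d)} {b : ℝ} {m : ℕ}
    {V : S → ℝ} {w : Fin d → ℝ} {G : Matrix (Fin d) (Fin d) ℝ} (h : IsNashEstimate φ b m V w G)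
    (s : S) : V s ∈ Set.Icc (0 : ℝ) m := by
  obtain ⟨p, q, hp, hq, -, h⟩ := h.nash s
  rw [h]
  exact matrixPayoff_mem_Icc (fun x y => regulate_mem_Icc _ _) p q

/-- The value function inherits the stability of the payoffs, although the equilibria themselves may
jump. -/
lemma IsNashEstimate.abs_sub_le [Finite A] [Finite B]
    {φ : S × A × B → EuclideanSpace ℝ (Fin d)} (hφ : ∀ z, ‖φ z‖ ≤ 1)
    {b : ℝ} {m : ℕ} {V V' : S → ℝ} {w w' : Fin d → ℝ} {G G' : Matrix (Fin d) (Fin d) ℝ}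
    (h : IsNashEstimate φ b m V w G) (h' : IsNashEstimate φ b m V' w' G') {η : ℝ} (hη : 0 ≤ η)
    (hw : ∀ i, |w i - w' i| ≤ η) (hG : ∀ i j, |G i j - G' i j| ≤ η) (s : S) :
    |V s - V' s| ≤ d * η + |b| * (d * √η) := by
  obtain ⟨p, q, hp, hq, hN, h⟩ := h.nash s
  obtain ⟨p', q', hp', hq', hN', h'⟩ := h'.nash s
  have h1 := hN.payoff_le_add (payoffEstimate_le_add hφ b m hw hG hη s) hN'
  have h2 := hN'.payoff_le_add (payoffEstimate_le_add hφ b m (w := w') (w' := w) (G := G')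
    (G' := G) (fun i => by rw [abs_sub_comm]; exact hw i)
    (fun i j => by rw [abs_sub_comm]; exact hG i j) hη s) hN
  rw [h, h', abs_le]
  constructor <;> linarith

end Estimate

/-! ### Uniform concentration over the class of value functions. -/

namespace Dataset

variable {S A B Ω : Type*} [MeasurableSpace S] [MeasurableSpace A] [MeasurableSpace B]
  {H K d : ℕ}

/-- The compensated exponent of the noise supermartingale in direction `v`. -/
noncomputable def noiseExponent (M : MarkovGame S A B H)
    (φ : S × A × B → EuclideanSpace ℝ (Fin d)) (D : Dataset S A B H K) (h : Fin H) (V : S → ℝ)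
    (v : Fin d → ℝ) : ℝ :=
  ∑ τ, (((φ (D.triple h τ)).ofLp ⬝ᵥ v) * D.noise M h V τ
    - (H : ℝ) ^ 2 / 2 * ((φ (D.triple h τ)).ofLp ⬝ᵥ v) ^ 2)

variable {M : MarkovGame S A B H} {φ : S × A × B → EuclideanSpace ℝ (Fin d)}

lemma abs_noise_le (D : Dataset S A B H K) (h : Fin H) {V : S → ℝ} (hV : Measurable V) {R : ℝ}
    (hVR : ∀ s, V s ∈ Set.Icc 0 R) (τ : Fin K) : |D.noise M h V τ| ≤ R := by
  have h1 := integral_mem_Icc hV (M.trans h (D.triple h τ)) hVR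
  have h2 := hVR (D.state h.succ τ)
  rw [noise, abs_le]
  constructor <;> linarith [h1.1, h1.2, h2.1, h2.2]

lemma abs_noise_sub_le (D : Dataset S A B H K) (h : Fin H) {V V' : S → ℝ} (hV : Measurable V)
    (hV' : Measurable V') {R : ℝ} (hVR : ∀ s, V s ∈ Set.Icc 0 R) (hVR' : ∀ s, V' s ∈ Set.Icc 0 R)
    {e : ℝ} (he : ∀ s, |V s - V' s| ≤ e) (τ : Fin K) :
    |D.noise M h V τ - D.noise M h V' τ| ≤ 2 * e := by
  have h1 := integral_mem_Icc (hV.sub hV') (M.trans h (D.triple h τ)) (a := -e) (b := e)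
    fun s => abs_le.mp (he s)
  simp only [Pi.sub_apply] at h1
  rw [integral_sub ((BoundedMeasurable.of_mem_Icc hV hVR).integrable _)
    ((BoundedMeasurable.of_mem_Icc hV' hVR').integrable _)] at h1
  have h2 := abs_le.mp (he (D.state h.succ τ))
  rw [noise, noise, abs_le]
  constructor <;> linarith [h1.1, h1.2, h2.1, h2.2]

/-- The exponent is stable under small perturbations of `V` and `v`. -/
lemma noiseExponent_le_add (hφ : ∀ z, ‖φ z‖ ≤ 1) (D : Dataset S A B H K) (h : Fin H)
    {V V' : S → ℝ} (hV : Measurable V) (hV' : Measurable V')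
    (hVR : ∀ s, V s ∈ Set.Icc (0 : ℝ) H) (hVR' : ∀ s, V' s ∈ Set.Icc (0 : ℝ) H)
    {e : ℝ} (he : ∀ s, |V s - V' s| ≤ e) {v v' : Fin d → ℝ} {η R : ℝ}
    (hv : ∀ i, |v i - v' i| ≤ η) (hvR : ∀ i, |v i| ≤ R) (hvR' : ∀ i, |v' i| ≤ R) :
    D.noiseExponent M φ h V v ≤ D.noiseExponent M φ h V' v' +
      K * (d * R * (2 * e) + d * η * H + (H : ℝ) ^ 2 / 2 * (d * η * (2 * (d * R)))) := by
  have key : ∀ τ : Fin K, ((φ (D.triple h τ)).ofLp ⬝ᵥ v) * D.noise M h V τ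
      - (H : ℝ) ^ 2 / 2 * ((φ (D.triple h τ)).ofLp ⬝ᵥ v) ^ 2 ≤
      (((φ (D.triple h τ)).ofLp ⬝ᵥ v') * D.noise M h V' τ
      - (H : ℝ) ^ 2 / 2 * ((φ (D.triple h τ)).ofLp ⬝ᵥ v') ^ 2) +
      (d * R * (2 * e) + d * η * H + (H : ℝ) ^ 2 / 2 * (d * η * (2 * (d * R)))) := by
    intro τ
    have hu1 : ∀ i, |(φ (D.triple h τ)).ofLp i| ≤ 1 := fun i =>
      (EuclideanSpace.abs_apply_le_norm _ i).trans (hφ _)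
    have ha := Matrix.abs_dotProduct_le_sum _ v zero_le_one hu1 hvR
    have ha' := Matrix.abs_dotProduct_le_sum _ v' zero_le_one hu1 hvR'
    have had := Matrix.abs_dotProduct_le_sum _ (v - v') zero_le_one hu1 hv
    rw [dotProduct_sub] at had
    have hn := abs_noise_le (M := M) D h hV' hVR' τ
    have hnd := abs_noise_sub_le (M := M) D h hV hV' hVR hVR' he τ
    set a := (φ (D.triple h τ)).ofLp ⬝ᵥ v
    set a' := (φ (D.triple h τ)).ofLp ⬝ᵥ v'
    set n := D.noise M h V τ
    set n' := D.noise M h V' τ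
    rw [one_mul] at ha ha' had
    have h1 : a * (n - n') ≤ d * R * (2 * e) := by
      refine (le_abs_self _).trans ?_
      rw [abs_mul]
      exact mul_le_mul ha hnd (abs_nonneg _) ((abs_nonneg _).trans ha)
    have h2 : (a - a') * n' ≤ d * η * H := by
      refine (le_abs_self _).trans ?_
      rw [abs_mul]
      exact mul_le_mul had hn (abs_nonneg _) ((abs_nonneg _).trans had)
    have h3 : (a' - a) * (a' + a) ≤ d * η * (2 * (d * R)) := by
      refine (le_abs_self _).trans ?_
      rw [abs_mul, abs_sub_comm]
      refine mul_le_mul had ((abs_add_le _ _).trans (by linarith)) (abs_nonneg _)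
        ((abs_nonneg _).trans had)
    have h4 := mul_le_mul_of_nonneg_left h3 (by positivity : (0 : ℝ) ≤ (H : ℝ) ^ 2 / 2)
    nlinarith
  refine (Finset.sum_le_sum fun τ _ => key τ).trans_eq ?_
  rw [Finset.sum_add_distrib, noiseExponent, Finset.sum_const, Finset.card_univ, Fintype.card_fin,
    nsmul_eq_mul]

variable {m0 : MeasurableSpace Ω} {P : Measure Ω} [IsProbabilityMeasure P]
  {D : Ω → Dataset S A B H K} [DiscreteMeasurableSpace A] [DiscreteMeasurableSpace B]
  [Finite A] [Finite B]

/-- Uniform concentration over all Nash estimates with bounded parameters. -/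
lemma IsCompliant.exists_uniform_event (hD : IsCompliant P M D) (hφm : Measurable φ)
    (hφ : ∀ z, ‖φ z‖ ≤ 1) (h : Fin H) (b : ℝ) {m : ℕ} (hm : m ≤ H) (N : ℕ) {η : ℝ} (hη : 0 < η)
    (ℓ : ℝ) :
    ∃ E : Set Ω, MeasurableSet E ∧
      P.real Eᶜ ≤ (2 * N + 1 : ℝ) ^ (d + d * d + d) * Real.exp (-ℓ) ∧
      ∀ ω ∈ E, ∀ (V : S → ℝ) (w : Fin d → ℝ) (G : Matrix (Fin d) (Fin d) ℝ) (v : Fin d → ℝ),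
        IsNashEstimate φ b m V w G → (∀ i, |w i| ≤ N * η) → (∀ i j, |G i j| ≤ N * η) →
        (∀ i, |v i| ≤ N * η) →
        (D ω).noiseExponent M φ h V v ≤ ℓ + K * (d * (N * η) * (2 * (d * η + |b| * (d * √η)))
          + d * η * H + (H : ℝ) ^ 2 / 2 * (d * η * (2 * (d * (N * η))))) := by
  -- A point of the net carries a value function, its parameters and a direction. All are
  -- deterministic, so the tail bound for fixed functions applies at each point; `V` itself needs no
  -- coordinates, being stable in `w` and `G`.
  let X := {x : (S → ℝ) × (Fin d → ℝ) × Matrix (Fin d) (Fin d) ℝ × (Fin d → ℝ) //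
    IsNashEstimate φ b m x.1 x.2.1 x.2.2.1 ∧ (∀ i, |x.2.1 i| ≤ N * η) ∧
    (∀ i j, |x.2.2.1 i j| ≤ N * η) ∧ (∀ i, |x.2.2.2 i| ≤ N * η)}
  let f : X → (Fin d ⊕ Fin d × Fin d) ⊕ Fin d → ℝ := fun x =>
    Sum.elim (Sum.elim x.1.2.1 fun ij => x.1.2.2.1 ij.1 ij.2) x.1.2.2.2
  obtain ⟨T, hTcard, hT⟩ := exists_finset_cover f N hη (by
    rintro ⟨x, -, h1, h2, h3⟩ ((i | ij) | i)
    exacts [h1 i, h2 ij.1 ij.2, h3 i])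
  have hrange : ∀ x : X, ∀ s, x.1.1 s ∈ Set.Icc (0 : ℝ) H := fun x s =>
    ⟨(x.2.1.mem_Icc s).1, (x.2.1.mem_Icc s).2.trans (by exact_mod_cast hm)⟩
  have hgm : ∀ v : Fin d → ℝ, Measurable fun z => (φ z).ofLp ⬝ᵥ v := fun v => by
    simp only [dotProduct]
    fun_prop
  let bad : X → Set Ω := fun x => {ω | ℓ ≤ (D ω).noiseExponent M φ h x.1.1 x.1.2.2.2}
  have hbadm : ∀ x, MeasurableSet (bad x) := fun x => by
    refine measurableSet_le measurable_const (Finset.measurable_fun_sum _ fun τ _ => ?_)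
    exact (measurable_increment M h x.2.1.measurable (hgm x.1.2.2.2) _).comp
      ((hD.measurable_triple h τ).prodMk (hD.measurable_state h.succ τ))
  refine ⟨(⋃ x ∈ T, bad x)ᶜ, (T.measurableSet_biUnion fun x _ => hbadm x).compl, ?_, ?_⟩
  · rw [compl_compl]
    calc P.real (⋃ x ∈ T, bad x) ≤ ∑ x ∈ T, P.real (bad x) := measureReal_biUnion_finset_le _ _
      _ ≤ ∑ x ∈ T, Real.exp (-ℓ) := Finset.sum_le_sum fun x _ =>
        hD.measure_noise_ge_le h x.2.1.measurable (hrange x) (hgm _) ℓ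
      _ = T.card * Real.exp (-ℓ) := by simp
      _ ≤ _ := by
        gcongr
        have := hTcard
        simp only [Fintype.card_sum, Fintype.card_prod, Fintype.card_fin] at this
        exact_mod_cast this
  · intro ω hω V w G v hV hw hG hv
    let x : X := ⟨(V, w, G, v), hV, hw, hG, hv⟩
    obtain ⟨y, hyT, hy⟩ := hT x
    have hclose : ∀ s, |V s - y.1.1 s| ≤ d * η + |b| * (d * √η) :=
      hV.abs_sub_le hφ y.2.1 hη.le (fun i => hy (.inl (.inl i)))
        fun i j => hy (.inl (.inr (i, j)))
    have h1 := noiseExponent_le_add (M := M) hφ (D ω) h hV.measurable y.2.1.measurable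
      (hrange x) (hrange y) hclose (v := v) (v' := y.1.2.2.2) (fun i => hy (.inr i)) hv y.2.2.2.2
    have h2 : (D ω).noiseExponent M φ h y.1.1 y.1.2.2.2 < ℓ := by
      by_contra hcon
      exact hω (Set.mem_biUnion hyT (not_lt.mp hcon))
    linarith

end Dataset

/-! ### Bellman backups in a linear game. -/

/-- If a finite measure is a linear combination of signed measures on measurable sets, so is its
integral against bounded functions. -/
lemma integral_eq_sum_of_signedMeasure {X ι : Type*} [MeasurableSpace X] [Fintype ι]
    (ρ : Measure X) [IsFiniteMeasure ρ] (μ : ι → SignedMeasure X) (a : ι → ℝ)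
    (h : ∀ E, MeasurableSet E → ρ.real E = ∑ i, a i * μ i E) {V : X → ℝ}
    (hV : BoundedMeasurable V) :
    ∫ x, V x ∂ρ = ∑ i, a i * (∫ x, V x ∂(μ i).toJordanDecomposition.posPart
      - ∫ x, V x ∂(μ i).toJordanDecomposition.negPart) := by
  set pos := fun i => (μ i).toJordanDecomposition.posPart
  set neg := fun i => (μ i).toJordanDecomposition.negPart
  have hreal : ∀ (m : ι → Measure X) [∀ i, IsFiniteMeasure (m i)] (E : Set X),
      (∑ i, m i).real E = ∑ i, (m i).real E := fun m _ E => by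
    simp only [measureReal_def, Measure.finsetSum_apply,
      ENNReal.toReal_sum fun i _ => measure_ne_top (m i) E]
  -- Moving the negative terms to the left makes this an identity between positive measures, which
  -- can be checked on sets and then integrated.
  have hmeas : ρ + ∑ i, ((a i).toNNReal • neg i + (-a i).toNNReal • pos i) =
      ∑ i, ((a i).toNNReal • pos i + (-a i).toNNReal • neg i) := by
    ext E hE
    rw [← measureReal_eq_measureReal_iff, measureReal_add_apply, hreal,
      hreal, h E hE, ← Finset.sum_add_distrib]
    refine Finset.sum_congr rfl fun i _ => ?_
    rw [measureReal_add_apply, measureReal_add_apply, measureReal_nnreal_smul_apply,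
      measureReal_nnreal_smul_apply, measureReal_nnreal_smul_apply, measureReal_nnreal_smul_apply,
      (μ i).apply_eq_posPart_real_sub_negPart_real hE, Real.coe_toNNReal', Real.coe_toNNReal']
    have := max_zero_sub_max_neg_zero_eq_self (a i)
    simp only [pos, neg]
    linear_combination (-(pos i).real E + (neg i).real E) * this
  have key := congrArg (fun m => ∫ x, V x ∂m) hmeas
  rw [integral_add_measure (hV.integrable _) (hV.integrable _),
    integral_finsetSum_measure fun i _ => hV.integrable _,
    integral_finsetSum_measure fun i _ => hV.integrable _, ← eq_sub_iff_add_eq,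
    ← Finset.sum_sub_distrib] at key
  rw [key]
  refine Finset.sum_congr rfl fun i _ => ?_
  simp only [integral_add_measure (hV.integrable _) (hV.integrable _),
    integral_smul_nnreal_measure, NNReal.smul_def, smul_eq_mul, Real.coe_toNNReal']
  have := max_zero_sub_max_neg_zero_eq_self (a i)
  simp only [pos, neg]
  linear_combination ((∫ x, V x ∂pos i) - ∫ x, V x ∂neg i) * this

namespace MarkovGame.IsLinear

variable {S A B : Type*} [MeasurableSpace S] [MeasurableSpace A] [MeasurableSpace B] {H d : ℕ}
  {M : MarkovGame S A B H} {φ : S × A × B → EuclideanSpace ℝ (Fin d)}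
  {θ : Fin H → EuclideanSpace ℝ (Fin d)} {μ : Fin H → Fin d → SignedMeasure S}

/-- The Bellman operator of a linear game maps bounded functions to linear functions of the
features. -/
lemma exists_weight (hM : M.IsLinear φ θ μ) {W : ℝ}
    (hW : ∀ h i, (μ h i).totalVariation Set.univ ≤ ENNReal.ofReal W) (h : Fin H) {V : S → ℝ}
    (hV : Measurable V) {R : ℝ} (hVR : ∀ s, V s ∈ Set.Icc 0 R) (hR : 0 ≤ R) :
    ∃ w : Fin d → ℝ, (∀ z, M.reward h z + ∫ s, V s ∂M.trans h z = (φ z).ofLp ⬝ᵥ w) ∧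
      ∀ i, |w i| ≤ √(d : ℝ) + R * max W 0 := by
  refine ⟨fun i => θ h i + (∫ x, V x ∂(μ h i).toJordanDecomposition.posPart
      - ∫ x, V x ∂(μ h i).toJordanDecomposition.negPart), fun z => ?_, fun i => ?_⟩
  · rw [hM.reward_eq, integral_eq_sum_of_signedMeasure _ (μ h) (φ z)
      (fun E hE => hM.trans_eq h z E hE) (.of_mem_Icc hV hVR)]
    simp only [dotProduct, mul_add, Finset.sum_add_distrib]
  · refine (abs_add_le _ _).trans (add_le_add
      ((EuclideanSpace.abs_apply_le_norm _ i).trans (hM.norm_theta_le h)) ?_)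
    have hbound : ∀ m : Measure S, [IsFiniteMeasure m] →
        ∫ x, V x ∂m ∈ Set.Icc 0 (R * m.real Set.univ) := by
      intro m _
      refine ⟨integral_nonneg fun s => (hVR s).1, ?_⟩
      refine (integral_mono ((BoundedMeasurable.of_mem_Icc hV hVR).integrable m)
        (integrable_const R) fun s => (hVR s).2).trans_eq ?_
      simp [mul_comm]
    have h1 := hbound (μ h i).toJordanDecomposition.posPart
    have h2 := hbound (μ h i).toJordanDecomposition.negPart
    have h3 : (μ h i).toJordanDecomposition.posPart.real Set.univ +
        (μ h i).toJordanDecomposition.negPart.real Set.univ ≤ max W 0 := by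
      rw [← measureReal_add_apply]
      refine (ENNReal.toReal_mono ENNReal.ofReal_ne_top (hW h i)).trans_eq ?_
      rw [ENNReal.toReal_ofReal']
    have h4 := mul_le_mul_of_nonneg_left h3 hR
    rw [mul_add] at h4
    rw [abs_le]
    constructor <;> linarith [h1.1, h1.2, h2.1, h2.2]

end MarkovGame.IsLinear

/-! ### Self-normalized noise and the ridge regression error. -/

namespace Dataset

variable {S A B : Type*} [MeasurableSpace S] [MeasurableSpace A] [MeasurableSpace B]
  {H K d : ℕ} {M : MarkovGame S A B H} {φ : S × A × B → EuclideanSpace ℝ (Fin d)}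

/-- The feature-weighted noise of the regression. -/
noncomputable def noiseVec (M : MarkovGame S A B H) (φ : S × A × B → EuclideanSpace ℝ (Fin d))
    (D : Dataset S A B H K) (h : Fin H) (V : S → ℝ) (i : Fin d) : ℝ :=
  ∑ τ, φ (D.triple h τ) i * D.noise M h V τ

/-- A bound on the noise exponent in the optimal direction bounds the self-normalized noise. -/
lemma noiseVec_le_of_noiseExponent_le (D : Dataset S A B H K) (h : Fin H) {V : S → ℝ} {c : ℝ}
    (hc : D.noiseExponent M φ h V
      (((H : ℝ) ^ 2)⁻¹ • (D.gram φ h)⁻¹ *ᵥ D.noiseVec M φ h V) ≤ c) :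
    D.noiseVec M φ h V ⬝ᵥ (D.gram φ h)⁻¹ *ᵥ D.noiseVec M φ h V ≤ 2 * (H : ℝ) ^ 2 * c := by
  have hH : (0 : ℝ) < (H : ℝ) ^ 2 := by
    have : 0 < H := h.pos
    positivity
  set s := D.noiseVec M φ h V with hs
  set g := (D.gram φ h)⁻¹ *ᵥ s with hg
  set u : ℝ := ((H : ℝ) ^ 2)⁻¹ with hu
  have hGg : D.gram φ h *ᵥ g = s := by
    rw [hg, Matrix.mulVec_mulVec, Matrix.mul_nonsing_inv _
      ((Matrix.isUnit_iff_isUnit_det _).mp (gram_posDef φ D h).isUnit), Matrix.one_mulVec]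
  -- Since `Λ g = s`, the sum of the `(φ·g)²` is `g·s - g·g`. With `u = H⁻²` the exponent is thus at
  -- least `u (s·g) / 2`.
  have h1 : D.noiseExponent M φ h V (u • g) =
      u * (s ⬝ᵥ g) - (H : ℝ) ^ 2 / 2 * (u ^ 2 * (g ⬝ᵥ s - g ⬝ᵥ g)) := by
    have e1 : s ⬝ᵥ g = ∑ τ, ((φ (D.triple h τ)).ofLp ⬝ᵥ g) * D.noise M h V τ := by
      simp only [hs, noiseVec, dotProduct, Finset.sum_mul]
      rw [Finset.sum_comm]
      refine Finset.sum_congr rfl fun τ _ => Finset.sum_congr rfl fun i _ => by ring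
    have e2 := dotProduct_gram φ D h g g
    rw [hGg] at e2
    rw [e1, e2, add_sub_cancel_right, noiseExponent, Finset.sum_sub_distrib, Finset.mul_sum,
      Finset.mul_sum, Finset.mul_sum]
    congr 1
    · refine Finset.sum_congr rfl fun τ _ => ?_
      rw [dotProduct_smul, smul_eq_mul]
      ring
    · refine Finset.sum_congr rfl fun τ _ => ?_
      rw [dotProduct_smul, smul_eq_mul, dotProduct_comm g]
      ring
  rw [h1, dotProduct_comm g s] at hc
  have h2 : 0 ≤ g ⬝ᵥ g := by simpa using dotProduct_star_self_nonneg g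
  have h3 : (H : ℝ) ^ 2 * u = 1 := mul_inv_cancel₀ hH.ne'
  have hu0 : 0 ≤ u := by positivity
  have h4 : u * (s ⬝ᵥ g) / 2 ≤ c := by
    have h5 : (H : ℝ) ^ 2 / 2 * (u ^ 2 * (s ⬝ᵥ g - g ⬝ᵥ g)) =
        (u * (s ⬝ᵥ g) - u * (g ⬝ᵥ g)) / 2 := by
      linear_combination (u * (s ⬝ᵥ g - g ⬝ᵥ g) / 2) * h3
    have h6 := mul_nonneg hu0 h2
    linarith
  calc s ⬝ᵥ g = 2 * (H : ℝ) ^ 2 * (u * (s ⬝ᵥ g) / 2) := by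
        linear_combination (-(s ⬝ᵥ g)) * h3
    _ ≤ _ := by gcongr

/-- The regression error is controlled by the bonus. -/
lemma abs_ridge_sub_le (D : Dataset S A B H K) (h : Fin H)
    (hr : ∀ τ, D.rew h τ = M.reward h (D.triple h τ)) {V : S → ℝ} {w : Fin d → ℝ}
    (hw : ∀ z, M.reward h z + ∫ s, V s ∂M.trans h z = (φ z).ofLp ⬝ᵥ w) {a b : ℝ}
    (ha : D.noiseVec M φ h V ⬝ᵥ (D.gram φ h)⁻¹ *ᵥ D.noiseVec M φ h V ≤ a ^ 2) (ha0 : 0 ≤ a)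
    (hb : w ⬝ᵥ w ≤ b ^ 2) (hb0 : 0 ≤ b) (z : S × A × B) :
    |(φ z).ofLp ⬝ᵥ D.ridge φ h V - (M.reward h z + ∫ s, V s ∂M.trans h z)| ≤
      D.bonus φ (a + b) h z := by
  have hG := gram_posDef φ D h
  have hdet := (Matrix.isUnit_iff_isUnit_det _).mp hG.isUnit
  set s := D.noiseVec M φ h V with hs
  -- The regression target is the noise plus `(Λ - 1) w`, so applying `Λ⁻¹` leaves the errors `Λ⁻¹
  -- s` and `-Λ⁻¹ w`.
  have h1 : (fun i => ∑ τ, φ (D.triple h τ) i * (D.rew h τ + V (D.state h.succ τ))) =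
      s + (D.gram φ h *ᵥ w - w) := by
    ext i
    have e := dotProduct_gram φ D h (Pi.single i 1) w
    simp only [single_dotProduct, one_mul] at e
    simp only [Pi.add_apply, Pi.sub_apply, hs, noiseVec, e, add_sub_cancel_right]
    rw [← Finset.sum_add_distrib]
    refine Finset.sum_congr rfl fun τ _ => ?_
    rw [← hw, hr, noise]
    ring
  have h2 : D.ridge φ h V = (D.gram φ h)⁻¹ *ᵥ s + (w - (D.gram φ h)⁻¹ *ᵥ w) := by
    rw [ridge, h1, Matrix.mulVec_add, Matrix.mulVec_sub, Matrix.mulVec_mulVec,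
      Matrix.nonsing_inv_mul _ hdet, Matrix.one_mulVec]
  have hcs : ∀ (y : Fin d → ℝ) (c : ℝ), y ⬝ᵥ (D.gram φ h)⁻¹ *ᵥ y ≤ c ^ 2 → 0 ≤ c →
      |(φ z).ofLp ⬝ᵥ (D.gram φ h)⁻¹ *ᵥ y| ≤
        c * √((φ z).ofLp ⬝ᵥ (D.gram φ h)⁻¹ *ᵥ (φ z).ofLp) := by
    intro y c hy hc
    have h3 : 0 ≤ (φ z).ofLp ⬝ᵥ (D.gram φ h)⁻¹ *ᵥ (φ z).ofLp := by
      simpa using hG.inv.posSemidef.dotProduct_mulVec_nonneg (φ z).ofLp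
    refine abs_le_of_sq_le_sq ?_ (by positivity)
    rw [mul_pow, Real.sq_sqrt h3, mul_comm]
    exact (hG.inv.posSemidef.dotProduct_mulVec_sq_le _ _).trans
      (mul_le_mul_of_nonneg_left hy h3)
  have h4 := hcs s a ha ha0
  have h5 := hcs w b (((hG.dotProduct_inv_mulVec_bounds (dotProduct_self_le_gram φ D h) w).2).trans
    hb) hb0
  rw [hw, h2, dotProduct_add, dotProduct_sub, bonus, add_mul]
  rw [abs_le] at h4 h5 ⊢
  constructor <;> linarith [h4.1, h4.2, h5.1, h5.2]

end Dataset

/-! ### Truncation against the backup, and expected bonuses under coverage. -/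

lemma regulate_sub_bounds {m : ℕ} {y B g : ℝ} (h : |y - B| ≤ g) (hB : B ∈ Set.Icc (0 : ℝ) m) :
    regulate m (y - g) ≤ B ∧ B ≤ regulate m (y - g) + 2 * g := by
  have hg := (abs_nonneg _).trans h
  rw [abs_le] at h
  unfold regulate
  constructor
  · exact (min_le_right _ _).trans (max_le (by linarith) hB.1)
  · rw [← sub_le_iff_le_add]
    exact le_min (by linarith [hB.2]) (le_max_of_le_left (by linarith))

lemma regulate_add_bounds {m : ℕ} {y B g : ℝ} (h : |y - B| ≤ g) (hB : B ∈ Set.Icc (0 : ℝ) m) :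
    B ≤ regulate m (y + g) ∧ regulate m (y + g) ≤ B + 2 * g := by
  have hg := (abs_nonneg _).trans h
  rw [abs_le] at h
  unfold regulate
  constructor
  · exact le_min hB.2 (le_max_of_le_left (by linarith))
  · exact (min_le_right _ _).trans (max_le (by linarith) (by linarith [hB.1]))

namespace Dataset

variable {S A B : Type*} {H K d : ℕ} {φ : S × A × B → EuclideanSpace ℝ (Fin d)}

lemma quadForm_inv_gram_mem_Icc (hφ : ∀ z, ‖φ z‖ ≤ 1) (D : Dataset S A B H K) (h : Fin H)
    (z : S × A × B) :
    (φ z).ofLp ⬝ᵥ (D.gram φ h)⁻¹ *ᵥ (φ z).ofLp ∈ Set.Icc (0 : ℝ) 1 := by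
  have hG := gram_posDef φ D h
  constructor
  · simpa using hG.inv.posSemidef.dotProduct_mulVec_nonneg (φ z).ofLp
  · refine ((hG.dotProduct_inv_mulVec_bounds (dotProduct_self_le_gram φ D h) _).2).trans ?_
    rw [EuclideanSpace.dotProduct_self_eq]
    exact pow_le_one₀ (norm_nonneg _) (hφ z)

variable [MeasurableSpace S] [MeasurableSpace A] [MeasurableSpace B]

lemma boundedMeasurable_quadForm (hφm : Measurable φ) (hφ : ∀ z, ‖φ z‖ ≤ 1)
    (D : Dataset S A B H K) (h : Fin H) :
    BoundedMeasurable fun z => (φ z).ofLp ⬝ᵥ (D.gram φ h)⁻¹ *ᵥ (φ z).ofLp := by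
  refine .of_mem_Icc ?_ (quadForm_inv_gram_mem_Icc hφ D h)
  simp only [dotProduct, Matrix.mulVec]
  fun_prop

lemma boundedMeasurable_sqrt_quadForm (hφm : Measurable φ) (hφ : ∀ z, ‖φ z‖ ≤ 1)
    (D : Dataset S A B H K) (h : Fin H) :
    BoundedMeasurable fun z => √((φ z).ofLp ⬝ᵥ (D.gram φ h)⁻¹ *ᵥ (φ z).ofLp) :=
  .of_mem_Icc (boundedMeasurable_quadForm hφm hφ D h).1.sqrt fun z =>
    ⟨Real.sqrt_nonneg _, Real.sqrt_le_one.mpr (quadForm_inv_gram_mem_Icc hφ D h z).2⟩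

lemma boundedMeasurable_bonus (hφm : Measurable φ) (hφ : ∀ z, ‖φ z‖ ≤ 1) (β : ℝ)
    (D : Dataset S A B H K) (h : Fin H) : BoundedMeasurable (D.bonus φ β h) :=
  (boundedMeasurable_sqrt_quadForm hφm hφ D h).const_mul β

/-- Expresses the mean squared bonus through the moment matrix, the only quantity that coverage
controls. -/
lemma expect_quadForm_eq_trace (M : MarkovGame S A B H) (hφm : Measurable φ)
    (hφ : ∀ z, ‖φ z‖ ≤ 1) (D : Dataset S A B H K) (h : Fin H) (π : Policy S A H)
    (ν : Policy S B H) (x : S) :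
    M.expect π ν 0 x h (fun z => (φ z).ofLp ⬝ᵥ (D.gram φ h)⁻¹ *ᵥ (φ z).ofLp) =
      ((D.gram φ h)⁻¹ * M.featureMoment φ π ν x h).trace := by
  have hb : ∀ i j, BoundedMeasurable fun z => φ z i * φ z j := fun i j => by
    refine ⟨by fun_prop, 1, fun z => ?_⟩
    rw [abs_mul]
    exact mul_le_one₀ ((EuclideanSpace.abs_apply_le_norm _ i).trans (hφ z)) (abs_nonneg _)
      ((EuclideanSpace.abs_apply_le_norm _ j).trans (hφ z))
  have h1 : ∀ z, (φ z).ofLp ⬝ᵥ (D.gram φ h)⁻¹ *ᵥ (φ z).ofLp =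
      ∑ i, ∑ j, (D.gram φ h)⁻¹ i j * (φ z j * φ z i) := fun z => by
    simp only [dotProduct, Matrix.mulVec, Finset.mul_sum]
    exact Finset.sum_congr rfl fun i _ => Finset.sum_congr rfl fun j _ => by ring
  simp only [MarkovGame.expect, h1, Matrix.trace, Matrix.diag_apply, Matrix.mul_apply,
    MarkovGame.featureMoment, Matrix.of_apply]
  refine (integral_finsetSum _ fun i _ => integrable_finsetSum _ fun j _ =>
    ((hb j i).const_mul _).integrable _).trans (Finset.sum_congr rfl fun i _ => ?_)
  exact (integral_finsetSum _ fun j _ => ((hb j i).const_mul _).integrable _).trans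
    (Finset.sum_congr rfl fun j _ => integral_const_mul _ _)

/-- Under coverage the expected bonus is of order `β √(d / a)`. -/
lemma expect_bonus_le (M : MarkovGame S A B H) (hφm : Measurable φ) (hφ : ∀ z, ‖φ z‖ ≤ 1)
    (D : Dataset S A B H K) (h : Fin H) (π : Policy S A H) (ν : Policy S B H) (x : S) {β a : ℝ}
    (hβ : 0 ≤ β) (ha : 0 < a) (hd : 0 < d)
    (hc : (D.gram φ h - (1 + a • M.featureMoment φ π ν x h)).PosSemidef) :
    M.expect π ν 0 x h (D.bonus φ β h) ≤ β * √(d / a) := by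
  have hda : (0 : ℝ) < d / a := by positivity
  set r := √((d : ℝ) / a) with hr
  have hr0 : 0 < r := Real.sqrt_pos.mpr hda
  have hr2 : r ^ 2 = d / a := Real.sq_sqrt hda.le
  have hq := boundedMeasurable_quadForm hφm hφ D h
  have h1 : M.expect π ν 0 x h
      (fun z => (φ z).ofLp ⬝ᵥ (D.gram φ h)⁻¹ *ᵥ (φ z).ofLp) ≤ r ^ 2 := by
    rw [expect_quadForm_eq_trace M hφm hφ, hr2, le_div_iff₀ ha, mul_comm]
    exact trace_inv_gram_mul_le φ D h hc
  -- AM-GM with the weight `r = √(d / a)` replaces Jensen's inequality: once the mean of the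
  -- quadratic form is at most `r²`, both terms contribute at most `r / 2`.
  have hamgm : ∀ z, √((φ z).ofLp ⬝ᵥ (D.gram φ h)⁻¹ *ᵥ (φ z).ofLp) ≤
      (2 * r)⁻¹ * ((φ z).ofLp ⬝ᵥ (D.gram φ h)⁻¹ *ᵥ (φ z).ofLp) + r / 2 := fun z => by
    have h2 := Real.sq_sqrt (quadForm_inv_gram_mem_Icc hφ D h z).1
    set t := √((φ z).ofLp ⬝ᵥ (D.gram φ h)⁻¹ *ᵥ (φ z).ofLp)
    rw [← h2, ← sub_nonneg]
    have h3 : (2 * r)⁻¹ * t ^ 2 + r / 2 - t = (2 * r)⁻¹ * (t - r) ^ 2 := by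
      field_simp
      ring
    rw [h3]
    positivity
  have h4 : M.expect π ν 0 x h
      (fun z => √((φ z).ofLp ⬝ᵥ (D.gram φ h)⁻¹ *ᵥ (φ z).ofLp)) ≤ r := by
    refine (integral_mono ((boundedMeasurable_sqrt_quadForm hφm hφ D h).integrable _)
      (((hq.const_mul _).integrable _).add (integrable_const (r / 2))) hamgm).trans ?_
    rw [integral_add' ((hq.const_mul _).integrable _) (integrable_const _), integral_const_mul,
      integral_const, probReal_univ, one_smul]
    have h5 := mul_le_mul_of_nonneg_left h1 (by positivity : 0 ≤ (2 * r)⁻¹)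
    have h6 : (2 * r)⁻¹ * r ^ 2 = r / 2 := by field_simp
    unfold MarkovGame.expect at h5
    linarith
  exact (M.expect_const_mul π ν 0 x h β _).trans_le (mul_le_mul_of_nonneg_left h4 hβ)

end Dataset

/-! ### Value iteration: class membership, pessimism and optimism. -/

namespace IsValueIteration

variable {S A B : Type*} [MeasurableSpace S] [MeasurableSpace A] [DiscreteMeasurableSpace A]
  [MeasurableSpace B] [DiscreteMeasurableSpace B] {H K d : ℕ}
  {φ : S × A × B → EuclideanSpace ℝ (Fin d)} {β ε : ℝ} {D : Dataset S A B H K}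
  {V : Fin (H + 1) → S → ℝ} {Q : Fin H → S → A → B → ℝ} {p : Policy S A H} {q : Policy S B H}

lemma mem_Icc (hV : IsValueIteration φ β ε D V Q p q) (k : Fin (H + 1)) (s : S) :
    V k s ∈ Set.Icc (0 : ℝ) ((H - k : ℕ) : ℝ) := by
  induction k using Fin.lastCases with
  | last => simp [hV.terminal]
  | cast h =>
    rw [hV.value]
    refine matrixPayoff_mem_Icc (fun a b => ?_) _ _
    rw [hV.estimate]
    exact regulate_mem_Icc _ _

/-- Each value function is the integral of its payoff against the Markov kernel of play, so
measurability comes from the selected equilibria being policies. -/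
lemma boundedMeasurable (hV : IsValueIteration φ β ε D V Q p q) (hφm : Measurable φ)
    (k : Fin (H + 1)) : BoundedMeasurable (V k) := by
  refine .of_mem_Icc ?_ (hV.mem_Icc k)
  induction k using Fin.lastCases with
  | last => simp [funext hV.terminal]
  | cast h =>
    have hQ : BoundedMeasurable fun z : S × A × B => Q h z.1 z.2.1 z.2.2 := by
      simp only [hV.estimate]
      refine .of_mem_Icc ((measurable_regulate _).comp ?_) fun z => regulate_mem_Icc _ _
      simp only [Dataset.bonus, dotProduct, Matrix.mulVec]
      fun_prop
    have h1 : V h.castSucc = fun s => ∫ z, Q h z.1 z.2.1 z.2.2 ∂MarkovGame.playKernel p q h s := by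
      ext s
      rw [hV.value, MarkovGame.integral_playKernel _ _ _ _ hQ]
    rw [h1]
    exact (hQ.integral_kernel _).1

/-- The value functions of the iteration belong to the class of Nash estimates. -/
lemma exists_isNashEstimate (hV : IsValueIteration φ β ε D V Q p q) (hφm : Measurable φ)
    (hφ : ∀ z, ‖φ z‖ ≤ 1) (hr : ∀ h τ, D.rew h τ ∈ Set.Icc (0 : ℝ) 1) (h : Fin H) :
    ∃ w G, IsNashEstimate φ (ε * β) (H - (h + 1)) (V h.succ) w G ∧
      (∀ i, |w i| ≤ d * (K * (1 + H))) ∧ ∀ i j, |G i j| ≤ 1 := by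
  have hm := (hV.boundedMeasurable hφm h.succ).1
  rcases Fin.eq_castSucc_or_eq_last h.succ with ⟨k, hk⟩ | hk
  · have hkv : (h : ℕ) + 1 = k := by simpa using congrArg Fin.val hk
    have hQ : ∀ s, Q k s = payoffEstimate φ (ε * β) (H - (h + 1)) (D.ridge φ k (V k.succ))
        (D.gram φ k)⁻¹ s := fun s => by
      ext a b
      rw [hV.estimate, payoffEstimate, Dataset.bonus, hkv, mul_assoc]
    refine ⟨D.ridge φ k (V k.succ), (D.gram φ k)⁻¹, ⟨hm, fun s =>
      ⟨p.act k s, q.act k s, inferInstance, inferInstance, ?_, ?_⟩⟩, fun i => ?_, fun i j => ?_⟩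
    · rw [← hQ]; exact hV.nash k s
    · rw [hk, ← hQ]; exact hV.value k s
    · refine Dataset.abs_inv_gram_mulVec_le φ D k
        (Dataset.abs_sum_feature_mul_le hφ D k fun τ => ?_) i
      have h1 := hr k τ
      have h2 := hV.mem_Icc k.succ (D.state k.succ τ)
      have h3 : ((H - (k.succ : ℕ) : ℕ) : ℝ) ≤ H := by exact_mod_cast Nat.sub_le _ _
      rw [abs_of_nonneg (add_nonneg h1.1 h2.1)]
      exact add_le_add h1.2 (h2.2.trans h3)
    · exact (D.gram_posDef φ k).abs_inv_apply_le (D.dotProduct_self_le_gram φ k) i j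
  -- After the last step the truncation level is `0`: the payoff vanishes, every pair of strategies
  -- is an equilibrium, and zero parameters represent the terminal value.
  · have hkv : (h : ℕ) + 1 = H := by simpa using congrArg Fin.val hk
    have h0 : ∀ s, payoffEstimate φ (ε * β) (H - (h + 1)) 0 0 s = fun _ _ => 0 := fun s => by
      ext a b
      simp [payoffEstimate, regulate, hkv]
    refine ⟨0, 0, ⟨hm, fun s => ⟨p.act h s, q.act h s, inferInstance, inferInstance, ?_, ?_⟩⟩,
      fun i => ?_, fun i j => ?_⟩
    · rw [h0]
      simp [IsMatrixNash, matrixPayoff]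
    · rw [h0, hk, hV.terminal]
      simp [matrixPayoff]
    · simp only [Pi.zero_apply, abs_zero]; positivity
    · simp

variable (M : MarkovGame S A B H)

lemma bellman_mem_Icc (hV : IsValueIteration φ β ε D V Q p q) (hφm : Measurable φ) (h : Fin H)
    (z : S × A × B) :
    M.reward h z + ∫ s, V h.succ s ∂M.trans h z ∈ Set.Icc (0 : ℝ) ((H - h : ℕ) : ℝ) := by
  have h1 := M.reward_mem h z
  have h2 := integral_mem_Icc (hV.boundedMeasurable hφm h.succ).1 (M.trans h z)
    (hV.mem_Icc h.succ)
  refine ⟨add_nonneg h1.1 h2.1, (add_le_add h1.2 h2.2).trans_eq ?_⟩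
  have : H - (h : ℕ) = 1 + (H - (h.succ : ℕ)) := by
    have := h.2
    simp only [Fin.val_succ]
    omega
  rw [this]
  push_cast
  rfl

variable {M} [Finite A] [Finite B]

/-- Pessimism: the lower value bounds the value of the output policy against any opponent. -/
lemma le_value (hV : IsValueIteration φ β (-1) D V Q p q) (hφm : Measurable φ)
    (hconf : ∀ h z, |(φ z).ofLp ⬝ᵥ D.ridge φ h (V h.succ) -
      (M.reward h z + ∫ s, V h.succ s ∂M.trans h z)| ≤ D.bonus φ β h z)
    (ν : Policy S B H) (x : S) : V 0 x ≤ M.value p ν 0 x := by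
  have h0 := M.le_value_add p ν x (U := V) (g := fun _ _ => 0) (hV.boundedMeasurable hφm)
    (fun k => ⟨measurable_const, 0, by simp⟩) hV.terminal fun k s => by
      rw [hV.value]
      refine ((hV.nash k s).2 (ν.act k s) inferInstance).trans
        (matrixPayoff_mono (fun a b => ?_) _ _)
      rw [hV.estimate, add_zero, neg_one_mul, ← sub_eq_add_neg]
      exact (regulate_sub_bounds (hconf k _) (hV.bellman_mem_Icc M hφm k _)).1
  simpa [MarkovGame.expect] using h0

/-- A deviation from the equilibrium strategy of the maximizing player cannot raise the payoff `Q`,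
and `Q` is at least the backup minus two bonuses. -/
lemma value_le_add_bonus (hV : IsValueIteration φ β (-1) D V Q p q) (hφm : Measurable φ)
    (hφ : ∀ z, ‖φ z‖ ≤ 1)
    (hconf : ∀ h z, |(φ z).ofLp ⬝ᵥ D.ridge φ h (V h.succ) -
      (M.reward h z + ∫ s, V h.succ s ∂M.trans h z)| ≤ D.bonus φ β h z)
    (π : Policy S A H) (x : S) :
    M.value π q 0 x ≤ V 0 x + ∑ k, 2 * M.expect π q 0 x k (D.bonus φ β k) := by
  simp only [← MarkovGame.expect_const_mul]
  refine M.value_le_add π q x (hV.boundedMeasurable hφm)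
    (fun k => (D.boundedMeasurable_bonus hφm hφ β k).const_mul 2) hV.terminal fun k s => ?_
  rw [hV.value]
  refine le_trans (matrixPayoff_mono (fun a b => ?_) _ _)
    ((hV.nash k s).1 (π.act k s) inferInstance)
  rw [hV.estimate, neg_one_mul, ← sub_eq_add_neg, sub_le_iff_le_add]
  exact (regulate_sub_bounds (hconf k _) (hV.bellman_mem_Icc M hφm k _)).2

/-- Optimism: the upper value bounds the value of the output policy against any opponent. -/
lemma value_le (hV : IsValueIteration φ β 1 D V Q p q) (hφm : Measurable φ)
    (hconf : ∀ h z, |(φ z).ofLp ⬝ᵥ D.ridge φ h (V h.succ) -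
      (M.reward h z + ∫ s, V h.succ s ∂M.trans h z)| ≤ D.bonus φ β h z)
    (π : Policy S A H) (x : S) : M.value π q 0 x ≤ V 0 x := by
  have h0 := M.value_le_add π q x (U := V) (g := fun _ _ => 0) (hV.boundedMeasurable hφm)
    (fun k => ⟨measurable_const, 0, by simp⟩) hV.terminal fun k s => by
      rw [hV.value]
      refine le_trans (matrixPayoff_mono (fun a b => ?_) _ _)
        ((hV.nash k s).1 (π.act k s) inferInstance)
      rw [hV.estimate, sub_zero, one_mul]
      exact (regulate_add_bounds (hconf k _) (hV.bellman_mem_Icc M hφm k _)).1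
  simpa [MarkovGame.expect] using h0

/-- A deviation of the minimizing player cannot lower the payoff `Q`, and `Q` is at most the backup
plus two bonuses. -/
lemma le_value_add_bonus (hV : IsValueIteration φ β 1 D V Q p q) (hφm : Measurable φ)
    (hφ : ∀ z, ‖φ z‖ ≤ 1)
    (hconf : ∀ h z, |(φ z).ofLp ⬝ᵥ D.ridge φ h (V h.succ) -
      (M.reward h z + ∫ s, V h.succ s ∂M.trans h z)| ≤ D.bonus φ β h z)
    (ν : Policy S B H) (x : S) :
    V 0 x ≤ M.value p ν 0 x + ∑ k, 2 * M.expect p ν 0 x k (D.bonus φ β k) := by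
  simp only [← MarkovGame.expect_const_mul]
  refine M.le_value_add p ν x (hV.boundedMeasurable hφm)
    (fun k => (D.boundedMeasurable_bonus hφm hφ β k).const_mul 2) hV.terminal fun k s => ?_
  rw [hV.value]
  refine ((hV.nash k s).2 (ν.act k s) inferInstance).trans (matrixPayoff_mono (fun a b => ?_) _ _)
  rw [hV.estimate, one_mul]
  exact (regulate_add_bounds (hconf k _) (hV.bellman_mem_Icc M hφm k _)).2

end IsValueIteration

/-! ### The duality gap on the good event. -/

/-- The deterministic suboptimality bound on the event that the regression errors are dominated by
the bonuses and the dataset covers the equilibrium. -/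
lemma MarkovGame.dualityGap_le {S A B : Type*} [MeasurableSpace S] [MeasurableSpace A]
    [DiscreteMeasurableSpace A] [MeasurableSpace B] [DiscreteMeasurableSpace B] [Finite A]
    [Finite B] {H K d : ℕ} {M : MarkovGame S A B H} {φ : S × A × B → EuclideanSpace ℝ (Fin d)}
    (hφm : Measurable φ) (hφ : ∀ z, ‖φ z‖ ≤ 1) {β c₁ : ℝ} (hβ : 0 ≤ β) (hc₁ : 0 < c₁)
    (hd : 0 < d) (hK : 0 < K) {D : Dataset S A B H K} {x : S} {πs πhat : Policy S A H}
    {νs νhat : Policy S B H} (hN : M.IsNash πs νs) (hcov : D.Covers M φ c₁ πs νs x)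
    (hconf : ∀ (ε : ℝ) V Q p q, (ε = -1 ∨ ε = 1) → IsValueIteration φ β ε D V Q p q →
      ∀ h z, |(φ z).ofLp ⬝ᵥ D.ridge φ h (V h.succ) -
        (M.reward h z + ∫ s, V h.succ s ∂M.trans h z)| ≤ D.bonus φ β h z)
    (hout : IsPMVIOutput φ β D πhat νhat) :
    M.dualityGap πhat νhat x ≤ 4 * (H * (β * √(d / (c₁ * K)))) := by
  obtain ⟨⟨V, Q, ν', hV⟩, V', Q', π', hV'⟩ := hout
  have hcV := hconf _ V Q _ _ (.inl rfl) hV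
  have hcV' := hconf _ V' Q' _ _ (.inr rfl) hV'
  have ha : 0 < c₁ * K := by positivity
  have : Nonempty (Policy S A H) := ⟨πs⟩
  have : Nonempty (Policy S B H) := ⟨νs⟩
  have h1 : (⨆ π, M.value π νhat 0 x) ≤ V' 0 x :=
    ciSup_le fun π => hV'.value_le hφm hcV' π x
  have h2 : V 0 x ≤ ⨅ ν, M.value πhat ν 0 x :=
    le_ciInf fun ν => hV.le_value hφm hcV ν x
  have h3 := hV.value_le_add_bonus hφm hφ hcV πs x
  have h4 := hV'.le_value_add_bonus hφm hφ hcV' νs x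
  -- The Nash value is the common reference: it dominates the value of `(π', νs)` and is dominated
  -- by that of `(πs, ν')`, so it cancels from the gap.
  have h5 := (hN 0 x).1 π'
  have h6 := (hN 0 x).2 ν'
  have hsum : ∀ (π : Policy S A H) (ν : Policy S B H),
      (∀ h, (D.gram φ h - (1 + (c₁ * K) • M.featureMoment φ π ν x h)).PosSemidef) →
      ∑ k, 2 * M.expect π ν 0 x k (D.bonus φ β k) ≤ 2 * (H * (β * √(d / (c₁ * K)))) := by
    intro π ν hc
    refine (Finset.sum_le_sum fun k _ => mul_le_mul_of_nonneg_left
      (D.expect_bonus_le M hφm hφ k π ν x hβ ha hd (hc k)) zero_le_two).trans_eq ?_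
    rw [Finset.sum_const, Finset.card_univ, Fintype.card_fin, nsmul_eq_mul]
    ring
  have h7 := hsum πs ν' fun h => (hcov h).1 ν'
  have h8 := hsum π' νs fun h => (hcov h).2 π'
  rw [dualityGap]
  linarith

/-! ### Numerical constants and the sample size. -/

/-- The discretization cost for mesh `k⁻¹²`, whose square root is `k⁻⁶`, and parameter box `k²`;
each of the four terms is at most `1 / 4`. -/
lemma perturbation_error_le_one {k d H β : ℝ} (hd : 1 ≤ d) (hH : 1 ≤ H)
    (hk : 8 * (d ^ 2 * H ^ 2) ≤ k) (hβ : 0 ≤ β) (hβk : β ≤ k) :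
    k * (d * k ^ 2 * (2 * (d * (k ^ 12)⁻¹ + β * (d * (k ^ 6)⁻¹))) + d * (k ^ 12)⁻¹ * H +
      H ^ 2 / 2 * (d * (k ^ 12)⁻¹ * (2 * (d * k ^ 2)))) ≤ 1 := by
  have hd2 : 1 ≤ d ^ 2 := one_le_pow₀ hd
  have hH2 : 1 ≤ H ^ 2 := one_le_pow₀ hH
  have h1 : d ^ 2 ≤ d ^ 2 * H ^ 2 := le_mul_of_one_le_right (by positivity) hH2
  have hdH : d * H ≤ d ^ 2 * H ^ 2 := by
    rw [← mul_pow]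
    exact le_self_pow₀ (one_le_mul_of_one_le_of_one_le hd hH) two_ne_zero
  have hk1 : 1 ≤ k := by linarith
  have hk0 : 0 < k := by linarith
  have heq : k * (d * k ^ 2 * (2 * (d * (k ^ 12)⁻¹ + β * (d * (k ^ 6)⁻¹))) + d * (k ^ 12)⁻¹ * H +
      H ^ 2 / 2 * (d * (k ^ 12)⁻¹ * (2 * (d * k ^ 2)))) =
      2 * d ^ 2 / k ^ 9 + 2 * d ^ 2 * β / k ^ 3 + d * H / k ^ 11 + d ^ 2 * H ^ 2 / k ^ 9 := by
    field_simp
  have hle : ∀ n, n ≠ 0 → k ≤ k ^ n := fun n hn => le_self_pow₀ hk1 hn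
  have t1 : 2 * d ^ 2 / k ^ 9 ≤ 1 / 4 := by
    rw [div_le_iff₀ (by positivity)]
    linarith [hle 9 (by norm_num)]
  have t2 : 2 * d ^ 2 * β / k ^ 3 ≤ 1 / 4 := by
    rw [div_le_iff₀ (by positivity)]
    have := mul_le_mul (by linarith : 2 * d ^ 2 ≤ 1 / 4 * k) hβk hβ (by positivity)
    have h3 : k ^ 2 ≤ k ^ 3 := pow_le_pow_right₀ hk1 (by norm_num)
    linarith
  have t3 : d * H / k ^ 11 ≤ 1 / 4 := by
    rw [div_le_iff₀ (by positivity)]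
    linarith [hle 11 (by norm_num)]
  have t4 : d ^ 2 * H ^ 2 / k ^ 9 ≤ 1 / 4 := by
    rw [div_le_iff₀ (by positivity)]
    linarith [hle 9 (by norm_num)]
  linarith

/-- The exponent is at most `3 d²` and the base at most `k ^ 15`, which gives `45 d² ζ`; the
prefactor and the additive `1` cost at most `ζ` each. -/
lemma log_cover_card_le {k H p : ℝ} {d : ℕ} (hd : 1 ≤ d) (hH : 1 ≤ H) (hk : 3 ≤ k) (hp : 0 < p)
    (hp1 : p < 1) (hζ : 1 ≤ Real.log (4 * d * H * k / p)) :
    Real.log (4 * H * (2 * k ^ 14 + 1) ^ (d + d * d + d) / p) + 1 ≤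
      47 * d ^ 2 * Real.log (4 * d * H * k / p) := by
  have hd' : (1 : ℝ) ≤ d := by exact_mod_cast hd
  set ζ := Real.log (4 * d * H * k / p) with hζdef
  have hdH : (1 : ℝ) ≤ d * H := one_le_mul_of_one_le_of_one_le hd' hH
  have h1 : Real.log (4 * H / p) ≤ ζ := by
    refine Real.log_le_log (by positivity) ?_
    refine div_le_div_of_nonneg_right ?_ hp.le
    have : H ≤ d * H * k := by nlinarith
    linarith
  have h2 : Real.log k ≤ ζ := by
    refine Real.log_le_log (by positivity) ?_
    rw [le_div_iff₀ hp]
    nlinarith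
  have h3 : Real.log (2 * k ^ 14 + 1) ≤ 15 * Real.log k := by
    rw [show (15 : ℝ) = (15 : ℕ) by norm_num, ← Real.log_pow]
    refine Real.log_le_log (by positivity) ?_
    have h14 : 1 ≤ k ^ 14 := one_le_pow₀ (by linarith)
    nlinarith
  have h4 : ((d + d * d + d : ℕ) : ℝ) ≤ 3 * d ^ 2 := by
    push_cast
    nlinarith
  have hk0 : 0 ≤ Real.log k := Real.log_nonneg (by linarith)
  rw [mul_div_right_comm, Real.log_mul (by positivity) (by positivity), Real.log_pow]
  have h5 : ((d + d * d + d : ℕ) : ℝ) * Real.log (2 * k ^ 14 + 1) ≤ 3 * d ^ 2 * (15 * ζ) := by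
    refine mul_le_mul h4 (h3.trans (by linarith)) (Real.log_nonneg ?_) (by positivity)
    have : 0 ≤ k ^ 14 := by positivity
    linarith
  have h6 : ζ ≤ d ^ 2 * ζ := le_mul_of_one_le_left (by linarith) (one_le_pow₀ hd')
  linarith

/-- The requirements on the number of trajectories hold eventually. -/
lemma exists_forall_sample_size {d H : ℕ} (hd : 0 < d) (hH : 0 < H) {p : ℝ} (hp : 0 < p)
    (c W : ℝ) :
    ∃ K₀ : ℕ, ∀ K : ℕ, K₀ ≤ K → 3 ≤ K ∧ 8 * ((d : ℝ) ^ 2 * (H : ℝ) ^ 2) ≤ K ∧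
      c * d * H * √(Real.log (4 * d * H * K / p)) ≤ K ∧
      1 + max W 0 ≤ √(Real.log (4 * d * H * K / p)) := by
  have hd' : (0 : ℝ) < d := by exact_mod_cast hd
  have hH' : (0 : ℝ) < H := by exact_mod_cast hH
  set a : ℝ := 4 * d * H / p with ha
  have ha0 : 0 < a := by positivity
  have htend : Filter.Tendsto (fun K : ℕ => a * K) Filter.atTop Filter.atTop :=
    tendsto_natCast_atTop_atTop.const_mul_atTop ha0
  have hlog := Real.tendsto_log_atTop.comp htend
  set C : ℝ := |c| * d * H + 1
  have hC : 0 < C := by positivity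
  -- The constant is chosen so that `log (a K) ≤ K / C`; with `√ζ ≤ ζ` this yields the bound on `β`.
  have hsmall := htend.eventually (Real.isLittleO_log_id_atTop.bound
    (show 0 < (C * a)⁻¹ by positivity))
  rw [← Filter.eventually_atTop]
  filter_upwards [Filter.eventually_ge_atTop 3,
    hlog.eventually_ge_atTop (max 1 ((1 + max W 0) ^ 2)),
    tendsto_natCast_atTop_atTop.eventually_ge_atTop (8 * ((d : ℝ) ^ 2 * (H : ℝ) ^ 2)), hsmall]
    with K h1 h2 h3 h4
  have heq : 4 * d * H * K / p = a * K := by rw [ha]; ring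
  rw [heq]
  simp only [Function.comp_apply, id_eq, Real.norm_eq_abs] at h2 h4
  set ζ := Real.log (a * K)
  have hζ1 : 1 ≤ ζ := (le_max_left _ _).trans h2
  refine ⟨h1, h3, ?_, ?_⟩
  · have h5 : √ζ ≤ ζ := by
      rw [Real.sqrt_le_left (by linarith)]
      nlinarith
    rw [abs_of_nonneg (by linarith), abs_of_nonneg (by positivity), mul_inv, mul_assoc,
      inv_mul_cancel_left₀ ha0.ne', ← div_eq_inv_mul, le_div_iff₀ hC] at h4
    calc c * d * H * √ζ ≤ C * √ζ := by
          gcongr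
          have := le_abs_self c
          have : c * d * H ≤ |c| * d * H := by gcongr
          linarith
      _ ≤ C * ζ := by gcongr
      _ ≤ K := by linarith
  · exact Real.le_sqrt_of_sq_le ((le_max_right _ _).trans h2)

/-! ### The coverage and confidence events. -/

namespace Dataset

variable {S A B Ω : Type*} [MeasurableSpace S] [MeasurableSpace A] [MeasurableSpace B]
  {H K d : ℕ} {M : MarkovGame S A B H} {φ : S × A × B → EuclideanSpace ℝ (Fin d)}
  {m0 : MeasurableSpace Ω} {P : Measure Ω} {D : Ω → Dataset S A B H K}

/-- Coverage ranges over a possibly uncountable family of policies, but each condition is closed in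
the Gram matrix. Their intersection is therefore closed and its preimage measurable. -/
lemma IsCompliant.measurableSet_covers (hD : IsCompliant P M D) (hφm : Measurable φ) (c₁ : ℝ)
    (πs : Policy S A H) (νs : Policy S B H) (x : S) :
    MeasurableSet {ω | (D ω).Covers M φ c₁ πs νs x} := by
  have hclosed : ∀ N : Matrix (Fin d) (Fin d) ℝ,
      IsClosed {G : Fin d → Fin d → ℝ | (Matrix.of G - N).PosSemidef} := by
    intro N
    simp only [Matrix.posSemidef_iff_dotProduct_mulVec, Set.ofPred_and, Set.ofPred_forall]
    have hcont : Continuous fun G : Fin d → Fin d → ℝ => Matrix.of G - N :=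
      (continuous_id (X := Matrix (Fin d) (Fin d) ℝ)).sub continuous_const
    refine (isClosed_eq hcont.matrix_conjTranspose hcont).inter (isClosed_iInter fun u => ?_)
    exact isClosed_le continuous_const
      (continuous_const.dotProduct (hcont.matrix_mulVec continuous_const))
  have hgram : ∀ h, Measurable fun ω => fun i j => (D ω).gram φ h i j := fun h => by
    refine measurable_pi_lambda _ fun i => measurable_pi_lambda _ fun j => ?_
    simp only [gram, Matrix.add_apply, Matrix.sum_apply, Matrix.of_apply]
    have hT := hD.measurable_triple h
    fun_prop
  have hset : {ω | (D ω).Covers M φ c₁ πs νs x} =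
      ⋂ h : Fin H, (fun ω => fun i j => (D ω).gram φ h i j) ⁻¹'
        ((⋂ ν : Policy S B H, {G : Fin d → Fin d → ℝ |
          (Matrix.of G - (1 + (c₁ * K) • M.featureMoment φ πs ν x h)).PosSemidef}) ∩
        ⋂ π : Policy S A H, {G : Fin d → Fin d → ℝ |
          (Matrix.of G - (1 + (c₁ * K) • M.featureMoment φ π νs x h)).PosSemidef}) := by
    ext ω
    simp only [Covers, Set.mem_ofPred_eq, Set.mem_iInter, Set.mem_preimage, Set.mem_inter_iff]
    rfl
  rw [hset]
  exact MeasurableSet.iInter fun h => hgram h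
    ((isClosed_iInter fun _ => hclosed _).inter (isClosed_iInter fun _ => hclosed _)).measurableSet

/-- The regression errors of the value iterations are dominated by the bonuses, provided that the
noise exponents are bounded uniformly over the Nash estimates. -/
lemma abs_ridge_sub_le_bonus [DiscreteMeasurableSpace A] [DiscreteMeasurableSpace B]
    {θ : Fin H → EuclideanSpace ℝ (Fin d)} {μ : Fin H → Fin d → SignedMeasure S}
    (hM : M.IsLinear φ θ μ) {W : ℝ}
    (hW : ∀ h i, (μ h i).totalVariation Set.univ ≤ ENNReal.ofReal W) {D : Dataset S A B H K}
    (hr : ∀ h τ, D.rew h τ = M.reward h (D.triple h τ)) (hd : 0 < d) {ζ β c ε : ℝ}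
    (hc : 11 ≤ c) (hβ : β = c * d * H * √ζ) (hζ : 1 + max W 0 ≤ √ζ) (h : Fin H) {R L : ℝ}
    (hR : d * (K * (1 + H)) ≤ R) (hR1 : 1 ≤ R) (hL : L ≤ 47 * d ^ 2 * ζ)
    (hexp : ∀ (V : S → ℝ) (w : Fin d → ℝ) (G : Matrix (Fin d) (Fin d) ℝ) (v : Fin d → ℝ),
      IsNashEstimate φ (ε * β) (H - (h + 1)) V w G → (∀ i, |w i| ≤ R) → (∀ i j, |G i j| ≤ R) →
      (∀ i, |v i| ≤ R) → D.noiseExponent M φ h V v ≤ L)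
    {V : Fin (H + 1) → S → ℝ} {Q : Fin H → S → A → B → ℝ} {p : Policy S A H} {q : Policy S B H}
    (hV : IsValueIteration φ β ε D V Q p q) (z : S × A × B) :
    |(φ z).ofLp ⬝ᵥ D.ridge φ h (V h.succ) - (M.reward h z + ∫ s, V h.succ s ∂M.trans h z)| ≤
      D.bonus φ β h z := by
  have hφm := hM.measurable_feature
  have hφ := hM.norm_feature_le
  have hH1 : (1 : ℝ) ≤ H := by exact_mod_cast h.pos
  have hd1 : (1 : ℝ) ≤ d := by exact_mod_cast hd
  have hW0 : 0 ≤ max W 0 := le_max_right _ _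
  have hζ1 : 1 ≤ √ζ := by linarith
  have hζ0 : 0 ≤ ζ := by
    by_contra hcon
    rw [Real.sqrt_eq_zero_of_nonpos (by linarith)] at hζ1
    linarith
  have hVH : ∀ s, V h.succ s ∈ Set.Icc (0 : ℝ) H := fun s =>
    ⟨(hV.mem_Icc _ s).1, (hV.mem_Icc _ s).2.trans (by exact_mod_cast Nat.sub_le _ _)⟩
  have hVm := (hV.boundedMeasurable hφm h.succ).1
  obtain ⟨w, G, hest, hw, hG⟩ := hV.exists_isNashEstimate hφm hφ
    (fun h τ => by rw [hr]; exact M.reward_mem h _) h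
  have hS : ∀ i, |D.noiseVec M φ h (V h.succ) i| ≤ K * H := fun i =>
    D.abs_sum_feature_mul_le hφ h (fun τ => D.abs_noise_le h hVm hVH τ) i
  have hnoise := D.noiseVec_le_of_noiseExponent_le h
    (hexp _ w G (((H : ℝ) ^ 2)⁻¹ • (D.gram φ h)⁻¹ *ᵥ D.noiseVec M φ h (V h.succ)) hest
      (fun i => (hw i).trans hR) (fun i j => (hG i j).trans hR1) fun i => by
        rw [Pi.smul_apply, smul_eq_mul, abs_mul, abs_of_nonneg (by positivity)]
        refine le_trans (mul_le_of_le_one_left (abs_nonneg _)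
          (inv_le_one_of_one_le₀ (one_le_pow₀ hH1))) ?_
        refine (D.abs_inv_gram_mulVec_le φ h hS i).trans (le_trans ?_ hR)
        gcongr
        linarith)
  obtain ⟨w', hw', hw'b⟩ := hM.exists_weight hW h hVm hVH (by positivity)
  -- The constant is `2 · 47 = 94`, rounded up to `10²`.
  have ha : D.noiseVec M φ h (V h.succ) ⬝ᵥ (D.gram φ h)⁻¹ *ᵥ D.noiseVec M φ h (V h.succ) ≤
      (10 * (d * H * √ζ)) ^ 2 := by
    refine hnoise.trans ?_
    rw [mul_pow, mul_pow, mul_pow, Real.sq_sqrt hζ0]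
    have h1 := mul_le_mul_of_nonneg_left hL (by positivity : (0 : ℝ) ≤ 2 * (H : ℝ) ^ 2)
    have h2 : 0 ≤ (d : ℝ) ^ 2 * (H : ℝ) ^ 2 * ζ := by positivity
    linarith
  -- Each coordinate is at most `√d · H √ζ` because `1 + max W 0 ≤ √ζ`; summing `d` squares costs
  -- another factor `d`.
  have hb : w' ⬝ᵥ w' ≤ (d * H * √ζ) ^ 2 := by
    have h1 : √(d : ℝ) + H * max W 0 ≤ √(d : ℝ) * (H * √ζ) := by
      have hsd : 1 ≤ √(d : ℝ) := Real.one_le_sqrt.mpr hd1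
      have h2 : 1 + H * max W 0 ≤ H * √ζ := by nlinarith
      have h3 : H * max W 0 ≤ √(d : ℝ) * (H * max W 0) :=
        le_mul_of_one_le_left (by positivity) hsd
      nlinarith
    have h0 : 0 ≤ √(d : ℝ) + H * max W 0 := by positivity
    refine (le_abs_self _).trans ((Matrix.abs_dotProduct_le_sum _ _ h0 hw'b hw'b).trans ?_)
    calc (d : ℝ) * ((√(d : ℝ) + H * max W 0) * (√(d : ℝ) + H * max W 0))
        ≤ d * ((√(d : ℝ) * (H * √ζ)) * (√(d : ℝ) * (H * √ζ))) := by gcongr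
      _ = d * (√(d : ℝ) ^ 2 * (H * √ζ) ^ 2) := by ring
      _ = _ := by rw [Real.sq_sqrt (by positivity)]; ring
  refine (D.abs_ridge_sub_le h (hr h) hw' ha (by positivity) hb (by positivity) z).trans ?_
  unfold bonus
  gcongr
  rw [hβ]
  have h3 : 0 ≤ (d : ℝ) * H * √ζ := by positivity
  nlinarith

/-- With high probability, the regression errors of every run of the algorithm are dominated by
the bonuses. -/
lemma IsCompliant.exists_confidence_event [DiscreteMeasurableSpace A] [DiscreteMeasurableSpace B]
    [Finite A] [Finite B] [IsProbabilityMeasure P] (hD : IsCompliant P M D)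
    {θ : Fin H → EuclideanSpace ℝ (Fin d)} {μ : Fin H → Fin d → SignedMeasure S}
    (hM : M.IsLinear φ θ μ) {W : ℝ}
    (hW : ∀ h i, (μ h i).totalVariation Set.univ ≤ ENNReal.ofReal W) (hd : 0 < d) (hH : 0 < H)
    {δ ζ β c : ℝ} (hδ : 0 < δ) (hδ1 : δ < 1) (hζ : ζ = Real.log (4 * d * H * K / δ))
    (hβ : β = c * d * H * √ζ) (hc : 11 ≤ c) (hK3 : 3 ≤ K)
    (hK : 8 * ((d : ℝ) ^ 2 * (H : ℝ) ^ 2) ≤ K) (hβK : β ≤ K) (hWζ : 1 + max W 0 ≤ √ζ) :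
    ∃ E : Set Ω, MeasurableSet E ∧ P.real Eᶜ ≤ δ / 2 ∧ ∀ ω ∈ E, ∀ (ε : ℝ) V Q p q,
      (ε = -1 ∨ ε = 1) → IsValueIteration φ β ε (D ω) V Q p q →
      ∀ h z, |(φ z).ofLp ⬝ᵥ (D ω).ridge φ h (V h.succ) -
        (M.reward h z + ∫ s, V h.succ s ∂M.trans h z)| ≤ (D ω).bonus φ β h z := by
  have hH1 : (1 : ℝ) ≤ H := by exact_mod_cast hH
  have hd1 : (1 : ℝ) ≤ d := by exact_mod_cast hd
  have hK3' : (3 : ℝ) ≤ K := by exact_mod_cast hK3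
  have hζ1 : 1 ≤ ζ := Real.one_le_sqrt.mp (by linarith [le_max_right W 0])
  have hβ0 : 0 ≤ β := by rw [hβ]; positivity
  -- With `N = K ^ 14` the box `N η = K²` contains all the weights, matrices and directions that
  -- occur, while the mesh keeps the perturbation error below one.
  set η : ℝ := ((K : ℝ) ^ 12)⁻¹ with hη
  have hη0 : 0 < η := by positivity
  -- This level gives each event failure probability at most `δ / (4 H)`; the `2 H` pairs of a step
  -- and a bonus sign total `δ / 2`.
  set ℓ : ℝ := Real.log (4 * H * (2 * (K : ℝ) ^ 14 + 1) ^ (d + d * d + d) / δ) with hℓ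
  have hNη : ((K ^ 14 : ℕ) : ℝ) * η = (K : ℝ) ^ 2 := by
    rw [hη]
    push_cast
    field_simp
  have hsη : √η = ((K : ℝ) ^ 6)⁻¹ := by
    rw [hη, Real.sqrt_inv, show (K : ℝ) ^ 12 = ((K : ℝ) ^ 6) ^ 2 by ring,
      Real.sqrt_sq (by positivity)]
  have hprob : (2 * ((K ^ 14 : ℕ) : ℝ) + 1) ^ (d + d * d + d) * Real.exp (-ℓ) = δ / (4 * H) := by
    rw [Real.exp_neg, hℓ, Real.exp_log (by positivity)]
    push_cast
    field_simp
  let sgn : Bool → ℝ := fun b => if b then 1 else -1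
  have hsgn : ∀ b, |sgn b| = 1 := by simp [sgn]
  choose E hEm hEp hE using fun hb : Fin H × Bool =>
    hD.exists_uniform_event hM.measurable_feature hM.norm_feature_le hb.1 (sgn hb.2 * β)
      (Nat.sub_le H (hb.1 + 1)) (K ^ 14) hη0 ℓ
  have hrm : MeasurableSet {ω | ∀ h τ, (D ω).rew h τ = M.reward h ((D ω).triple h τ)} := by
    simp only [Set.ofPred_forall]
    exact MeasurableSet.iInter fun h => MeasurableSet.iInter fun τ =>
      measurableSet_eq_fun (hD.measurable_rew h τ)
        ((M.measurable_reward h).comp (hD.measurable_triple h τ))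
  refine ⟨(⋂ hb, E hb) ∩ {ω | ∀ h τ, (D ω).rew h τ = M.reward h ((D ω).triple h τ)},
    (MeasurableSet.iInter hEm).inter hrm, ?_, ?_⟩
  · have h0 : P.real {ω | ∀ h τ, (D ω).rew h τ = M.reward h ((D ω).triple h τ)}ᶜ = 0 := by
      rw [measureReal_eq_zero_iff]
      exact hD.ae_rew_eq
    rw [Set.compl_inter, Set.compl_iInter]
    calc _ ≤ P.real (⋃ hb, (E hb)ᶜ) + 0 := by
          rw [← h0]; exact measureReal_union_le _ _
      _ ≤ ∑ hb, P.real (E hb)ᶜ := by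
          rw [add_zero]; exact measureReal_iUnion_fintype_le _
      _ ≤ ∑ _hb : Fin H × Bool, δ / (4 * H) :=
          Finset.sum_le_sum fun hb _ => (hEp hb).trans_eq hprob
      _ = δ / 2 := by
          simp only [Finset.sum_const, Finset.card_univ, Fintype.card_prod, Fintype.card_fin,
            Fintype.card_bool, nsmul_eq_mul]
          push_cast
          field_simp
          norm_num
  · rintro ω ⟨hω, hr⟩ ε V Q p q hε hV h z
    obtain ⟨b, rfl⟩ : ∃ b, sgn b = ε := by
      rcases hε with rfl | rfl
      exacts [⟨false, by simp [sgn]⟩, ⟨true, by simp [sgn]⟩]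
    have hexp := hE (h, b) ω (Set.mem_iInter.mp hω (h, b))
    simp only [hNη] at hexp
    refine abs_ridge_sub_le_bonus hM hW hr hd hc hβ hWζ h (R := (K : ℝ) ^ 2) ?_ ?_ ?_ hexp hV z
    · have h1 : (d : ℝ) * (1 + H) ≤ K := by
        have h2 : (d : ℝ) * (1 + H) ≤ 2 * (d * H) := by nlinarith
        have h3 : (d : ℝ) * H ≤ (d * H) ^ 2 :=
          le_self_pow₀ (one_le_mul_of_one_le_of_one_le hd1 hH1) two_ne_zero
        rw [mul_pow] at h3
        have h4 : 0 ≤ (d : ℝ) * H := by positivity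
        linarith
      nlinarith
    · exact one_le_pow₀ (by linarith)
    · have h1 := log_cover_card_le hd hH1 hK3' hδ hδ1 (hζ ▸ hζ1)
      have h2 := perturbation_error_le_one hd1 hH1 hK hβ0 hβK
      rw [← hζ] at h1
      rw [abs_mul, hsgn, one_mul, abs_of_nonneg hβ0, hsη]
      linarith

end Dataset

/-! ### The final rate and the theorem. -/

lemma final_rate_eq {c c₁ d H K ζ : ℝ} (hc₁ : 0 < c₁) (hd : 0 < d) (hK : 0 < K) :
    4 * (H * (c * d * H * √ζ * √(d / (c₁ * K)))) =
      4 * c / √c₁ * d ^ (3 / 2 : ℝ) * H ^ 2 * K ^ (-(1 / 2) : ℝ) * √ζ := by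
  rw [Real.rpow_neg hK.le, ← Real.sqrt_eq_rpow, show (3 / 2 : ℝ) = 1 + 1 / 2 by norm_num,
    Real.rpow_add hd, Real.rpow_one, ← Real.sqrt_eq_rpow, Real.sqrt_div hd.le,
    Real.sqrt_mul hc₁.le]
  have h1 := (Real.sqrt_pos.mpr hc₁).ne'
  have h2 := (Real.sqrt_pos.mpr hK).ne'
  field_simp

theorem corollary1 :
    -- an absolute constant: every `c ≥ c₀` is sufficiently large
    ∃ c₀ : ℝ, 0 < c₀ ∧ ∀ c : ℝ, c₀ ≤ c → ∀ c₁ : ℝ, 0 < c₁ →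
    -- `c'` depends only on `c` and `c₁`
    ∃ c' : ℝ, 0 < c' ∧
    -- `K₀` depends only on `c`, `c₁`, `d`, `H`, `p` and a bound `W` on the signed measures
    ∀ (d H : ℕ) (p : ℝ), 0 < p → p < 1 → ∀ W : ℝ, ∃ K₀ : ℕ, ∀ K : ℕ, K₀ ≤ K →
    ∀ (S A B : Type*) [MeasurableSpace S]
      [Fintype A] [Nonempty A] [MeasurableSpace A] [DiscreteMeasurableSpace A]
      [Fintype B] [Nonempty B] [MeasurableSpace B] [DiscreteMeasurableSpace B]
      (M : MarkovGame S A B H) (φ : S × A × B → EuclideanSpace ℝ (Fin d))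
      (θ : Fin H → EuclideanSpace ℝ (Fin d)) (μ : Fin H → Fin d → SignedMeasure S),
    M.IsLinear φ θ μ →
    (∀ h i, (μ h i).totalVariation Set.univ ≤ ENNReal.ofReal W) →
    ∀ (x : S) (πs : Policy S A H) (νs : Policy S B H), M.IsNash πs νs →
    ∀ (Ω : Type*) [MeasurableSpace Ω] (P : Measure Ω) [IsProbabilityMeasure P]
      (D : Ω → Dataset S A B H K),
    Dataset.IsCompliant P M D →
    1 - p / 2 ≤ P.real {ω | (D ω).Covers M φ c₁ πs νs x} →
    ∀ ζ β : ℝ, ζ = Real.log (4 * d * H * K / p) → β = c * d * H * √ζ →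
    ∃ E : Set Ω, MeasurableSet E ∧ 1 - p ≤ P.real E ∧
      ∀ ω ∈ E, ∀ (πhat : Policy S A H) (νhat : Policy S B H),
        IsPMVIOutput φ β (D ω) πhat νhat →
        M.dualityGap πhat νhat x ≤
          c' * (d : ℝ) ^ (3 / 2 : ℝ) * (H : ℝ) ^ 2 * (K : ℝ) ^ (-(1 / 2) : ℝ) * √ζ := by
  -- The constant `11` is `10` for the noise plus `1` for the regularization.
  refine ⟨11, by norm_num, fun c hc c₁ hc₁ => ⟨4 * c / √c₁, by positivity, ?_⟩⟩
  intro d H p hp hp1 W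
  by_cases hdH : 0 < d ∧ 0 < H
  · obtain ⟨hd, hH⟩ := hdH
    obtain ⟨K₀, hK₀⟩ := exists_forall_sample_size hd hH hp c W
    refine ⟨K₀, ?_⟩
    rintro K hK S A B _ _ _ _ _ _ _ _ _ M φ θ μ hM hW x πs νs hN Ω _ P _ D hD hcov ζ β rfl rfl
    obtain ⟨hK3, hK8, hβK, hWζ⟩ := hK₀ K hK
    obtain ⟨E, hEm, hEp, hE⟩ := hD.exists_confidence_event hM hW hd hH hp hp1 rfl rfl hc hK3 hK8
      hβK hWζ
    have hcm := hD.measurableSet_covers hM.measurable_feature c₁ πs νs x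
    have hd' : (0 : ℝ) < d := by exact_mod_cast hd
    have hK' : (0 : ℝ) < K := by exact_mod_cast (by omega : 0 < K)
    refine ⟨{ω | (D ω).Covers M φ c₁ πs νs x} ∩ E, hcm.inter hEm, ?_, ?_⟩
    · have h1 := measureReal_union_le (μ := P) {ω | (D ω).Covers M φ c₁ πs νs x}ᶜ Eᶜ
      rw [← Set.compl_inter, probReal_compl_eq_one_sub (hcm.inter hEm),
        probReal_compl_eq_one_sub hcm] at h1
      linarith
    · rintro ω ⟨hωc, hωE⟩ πhat νhat hout
      rw [← final_rate_eq hc₁ hd' hK']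
      exact M.dualityGap_le hM.measurable_feature hM.norm_feature_le (by positivity) hc₁ hd
        (by omega) hN hωc (hE ω hωE) hout
  · refine ⟨0, ?_⟩
    rintro K - S A B _ _ _ _ _ _ _ _ _ M φ θ μ hM - x πs νs - Ω _ P _ D - - ζ β - -
    -- With `d = 0` and a step to play, the transition probability of the whole space would be an
    -- empty sum. So only `H = 0` remains, and there the gap is zero.
    have hH : H = 0 := by
      by_contra hH
      have hd : d = 0 := by
        by_contra hd
        exact hdH ⟨Nat.pos_of_ne_zero hd, Nat.pos_of_ne_zero hH⟩
      subst hd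
      have := hM.trans_eq ⟨0, Nat.pos_of_ne_zero hH⟩ (x, Classical.arbitrary A,
        Classical.arbitrary B) Set.univ .univ
      simp at this
    subst hH
    refine ⟨Set.univ, .univ, by simp [hp.le], fun ω _ πhat νhat _ => ?_⟩
    simp [MarkovGame.dualityGap, MarkovGame.value]
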